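/- Setting. Let $n\ge 3$ and let $M=\Gamma\backslash\mathbb H^n$ be a complete oriented hyperbolic $n$-manifold, where $\Gamma<\mathrm{SO}^+(n,1)$ is discrete and torsion-free. For $A,B\in \mathrm{SO}(m)$, $A$ is $\epsilon$-close to $B$ if the angle between $v$ and $A^{-1}Bv$ is at most $\epsilon$ for every unit vector $v$. A closed geodesic of $M$ is $(R,\epsilon)$-good if its length $l$ satisfies $2R-2\epsilon<l<2R+2\epsilon$ and its monodromy (the rotation part in $\mathrm{SO}(n-1)$) is $\epsilon$-close to the identity. Pants. Write the fundamental group of a topological pair of pants $\Pi_0$ as $\pi_1(\Pi_0)=\langle c_0,c_1,c_2\mid c_0c_1c_2=1\rangle$, where $c_i$ is freely homotopic to the $i$-th oriented boundary curve. A pants group in $M$ is an injective homomorphism $\rho\colon\pi_1(\Pi_0)\to\pi_1(M)=\Gamma$, considered up to conjugacy. It is $(R,\epsilon)$-cuff-good if for each $i$ the free homotopy class of $\rho(c_i)$ is represented by an $(R,\epsilon)$-good closed geodesic. Tripods. A framed tripod at $p\in M$ is a pair $((v_0,v_1,v_2),E)$ of three unit tangent vectors at $p$ with mutual angles $2\pi/3$,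 and an orthonormal frame $E$ of the orthogonal complement of their plane $V$, such that each $E_i:=(v_i,v_i^\perp,E)$ is a positive frame of $T_pM$; here $v_i^\perp\in V$ is the unit vector orthogonal to $v_i$ at angle $\pi/6$ from $v_{i+1}$ (indices modulo $3$). Let $((u_0,u_1,u_2),F)$ be a framed tripod at $q$, with frames $F_i:=(u_i,u_i^\perp,F)$. The two framed tripods are $(R,\epsilon)$-well-connected by geodesic segments $\gamma_0,\gamma_1,\gamma_2$ of positive length from $p$ to $q$ if, for each $i\in\mathbb Z/3\mathbb Z$: 1. $R+\log\frac43-\epsilon<l(\gamma_i)<R+\log\frac43+\epsilon$; 2. the angle between $v_i$ and $\gamma_i'$ at $p$, and the angle between $u_{-i}$ and $-\gamma_i'$ at $q$, are at most $e^{-R/4}$; 3. if $\hat E_i$ is the frame at $q$ obtained from the parallel transport of $E_i$ along $\gamma_i$ by negating the first two vectors, then the matrix $X_i\in\mathrm{SO}(n)$ with $F_{-i}=\hat E_i\cdot X_i$ is $\epsilon$-close to the identity. They are $(R,\epsilon)$-badly-connected by the $\gamma_i$ if the same holds with "the identity" in 3 replaced by $\mathrm{diag}(1,-1,-1,1,\dots,1)$.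 A pants group $\rho$ is $(R,\epsilon)$-good (respectively $(R,\epsilon)$-bad) if there are two framed tripods in $M$ that are $(R,\epsilon)$-well-connected (respectively badly-connected) by segments $\gamma_0,\gamma_1,\gamma_2$ which generate $\rho$: up to a common change of base point, $\rho(c_i)$ is the homotopy class of the loop $\gamma_{i+1}\gamma_{i-1}^{-1}$ for all $i\in\mathbb Z/3\mathbb Z$. Theorem. There is a universal constant $C>0$ such that for every $\epsilon>0$ there is an $R_0=R_0(\epsilon)>0$ with the following property. For all $R>R_0$, all $n\ge3$ and all $M$ as above, every pants group in $M$ that is $(R,\epsilon)$-cuff-good is either $(R,C\epsilon)$-good or $(R,C\epsilon)$-bad. (The constants $C$ and $R_0$ do not depend on $n$ or $M$; "either ... or" is not meant to be exclusive.) -/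

import Mathlib

open scoped Matrix

namespace HypPants

noncomputable section

/-! ### The hyperboloid model of hyperbolic space -/

/-- Minkowski space `ℝ^{n,1}`; coordinate `0` is the time coordinate. -/
abbrev Mink (n : ℕ) : Type := Fin (n + 1) → ℝ

/-- The Lorentzian form `-x₀y₀ + x₁y₁ + ⋯ + xₙyₙ`. -/
def form {n : ℕ} (x y : Mink n) : ℝ := -(x 0 * y 0) + ∑ i : Fin n, x i.succ * y i.succ

/-- Hyperbolic `n`-space: the upper sheet of the hyperboloid. The tangent space at `x` is
`{v | form x v = 0}`, and the Riemannian metric on it is the restriction of `form`. -/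
def hyp (n : ℕ) : Set (Mink n) := {x | form x x = -1 ∧ 0 < x 0}

/-- `v` is a unit tangent vector of hyperbolic space at `x`. -/
def IsUnitTangent {n : ℕ} (x v : Mink n) : Prop := form x v = 0 ∧ form v v = 1

/-- The angle between two unit tangent vectors at the same point. -/
def angle {n : ℕ} (v w : Mink n) : ℝ := Real.arccos (form v w)

/-- The unit speed geodesic with initial point `x` and initial unit tangent vector `w`. -/
def geo {n : ℕ} (x w : Mink n) (t : ℝ) : Mink n := Real.cosh t • x + Real.sinh t • w

/-- The velocity of the geodesic `geo x w` at time `t`. -/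
def geoVel {n : ℕ} (x w : Mink n) (t : ℝ) : Mink n := Real.sinh t • x + Real.cosh t • w

/-- Parallel transport of the tangent vector `X` at `x` along `geo x w` from time `0` to time `t`:
the component along `w` is carried to the velocity vector and the orthogonal component stays
constant in Minkowski space. (The derivative in `t` is `form X w • geo x w t`, which is normal to
the hyperboloid, so that the covariant derivative vanishes.) -/
def transport {n : ℕ} (x w : Mink n) (t : ℝ) (X : Mink n) : Mink n :=
  (X - form X w • w) + form X w • geoVel x w t

/-- `f` is a positively oriented orthonormal frame of the tangent space at `x ∈ ℍⁿ`. -/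
structure IsPosFrame {n : ℕ} (x : Mink n) (f : Fin n → Mink n) : Prop where
  base : x ∈ hyp n
  tangent : ∀ i, form x (f i) = 0
  orthonormal : ∀ i j, form (f i) (f j) = if i = j then 1 else 0
  positive : 0 < Matrix.det (Matrix.of (Matrix.vecCons x f))

/-! ### Isometries and hyperbolic manifolds -/

/-- `SO⁺(n,1)`, the group of orientation preserving isometries of `ℍⁿ`: the matrices of determinant
one that preserve the Lorentzian form and the upper sheet of the hyperboloid. -/
def SOplus (n : ℕ) : Subgroup (Matrix.SpecialLinearGroup (Fin (n + 1)) ℝ) where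
  carrier := {g | (∀ x y : Mink n, form (g.1 *ᵥ x) (g.1 *ᵥ y) = form x y) ∧
    ∀ x : Mink n, g.1 *ᵥ x ∈ hyp n ↔ x ∈ hyp n}
  one_mem' := by
    constructor <;> intros <;> simp
  mul_mem' := by
    rintro a b ⟨ha, ha'⟩ ⟨hb, hb'⟩
    constructor
    · intro x y
      rw [Matrix.SpecialLinearGroup.coe_mul, ← Matrix.mulVec_mulVec, ← Matrix.mulVec_mulVec, ha, hb]
    · intro x
      rw [Matrix.SpecialLinearGroup.coe_mul, ← Matrix.mulVec_mulVec, ha', hb']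
  inv_mem' := by
    rintro a ⟨ha, ha'⟩
    have key : ∀ x : Mink n, a.1 *ᵥ ((a⁻¹).1 *ᵥ x) = x := by
      intro x
      rw [Matrix.mulVec_mulVec, ← Matrix.SpecialLinearGroup.coe_mul, mul_inv_cancel]
      simp
    constructor
    · intro x y
      rw [← ha, key, key]
    · intro x
      rw [← ha', key]

/-- `Γ` is a discrete torsion-free group of orientation preserving isometries of `ℍⁿ`, i.e. the
deck group (fundamental group) of a complete oriented hyperbolic manifold `M = Γ \ ℍⁿ`. -/
structure IsHyperbolicManifoldGroup {n : ℕ}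
    (Γ : Subgroup (Matrix.SpecialLinearGroup (Fin (n + 1)) ℝ)) : Prop where
  isometries : Γ ≤ SOplus n
  discrete : DiscreteTopology Γ
  torsionFree : ∀ g ∈ Γ, IsOfFinOrder g → g = 1

/-! ### Good curves -/

/-- The isometry `g` translates the geodesic `geo p w` by `l > 0` in its positive direction. If `g`
is a deck transformation of `M`, this geodesic projects to the closed geodesic of `M` in the free
homotopy class of `g`, and `l` is the length of this closed geodesic. -/
structure IsAxis {n : ℕ} (g : Matrix.SpecialLinearGroup (Fin (n + 1)) ℝ) (p w : Mink n) (l : ℝ) :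
    Prop where
  base : p ∈ hyp n
  unit : IsUnitTangent p w
  pos : 0 < l
  map_base : g.1 *ᵥ p = geo p w l
  map_dir : g.1 *ᵥ w = geoVel p w l

/-- The free homotopy class of the deck transformation `g` contains an `(R, ε)`-good closed
geodesic: its length is `2ε`-close to `2R`, and its monodromy turns every unit normal vector by an
angle of at most `ε`. The unit normal vectors `v` at `p` are the unit vectors orthogonal to `p` and
`w`; parallel transport along the geodesic fixes them as vectors of Minkowski space, so that the
monodromy (the rotation part of `g`) is the restriction of `g` to the orthogonal complement of
`p, w`. -/
def IsGoodCurve {n : ℕ} (R ε : ℝ) (g : Matrix.SpecialLinearGroup (Fin (n + 1)) ℝ) : Prop :=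
  ∃ (p w : Mink n) (l : ℝ), IsAxis g p w l ∧
    2 * R - 2 * ε < l ∧ l < 2 * R + 2 * ε ∧
    ∀ v : Mink n, IsUnitTangent p v → form w v = 0 → angle v (g.1 *ᵥ v) ≤ ε

/-! ### Pants -/

/-- The fundamental group of the topological pair of pants `Π₀`. -/
abbrev PantsGroup : Type := FreeGroup (Fin 2)

/-- Based loops `c₀, c₁, c₂` with `c₀ c₁ c₂ = 1`, freely homotopic to the three boundary components
of `Π₀` (with their boundary orientation). -/
def cuff : Fin 3 → PantsGroup :=
  ![FreeGroup.of 0, FreeGroup.of 1, (FreeGroup.of 0 * FreeGroup.of 1)⁻¹]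

/-- The pants `ρ` in `M = Γ \ ℍⁿ` is `(R, ε)`-cuff-good: each of its cuffs is an
`(R, ε)`-good curve. -/
def IsCuffGood {n : ℕ} {Γ : Subgroup (Matrix.SpecialLinearGroup (Fin (n + 1)) ℝ)}
    (R ε : ℝ) (ρ : PantsGroup →* Γ) : Prop :=
  ∀ i : Fin 3, IsGoodCurve R ε (ρ (cuff i)).1

/-! ### Framed tripods

The dimension is `n = d + 2`, so that the orthogonal complement of the plane of a tripod has
dimension `d`. Indices of the legs of a tripod are in `Fin 3`, with arithmetic modulo `3`. -/

/-- The unit vector `vᵢ^⊥` in the plane of the tripod `v` which is orthogonal to `vᵢ` and makes an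
angle of `π / 6` with `vᵢ₊₁`. -/
def perp {n : ℕ} (v : Fin 3 → Mink n) (i : Fin 3) : Mink n :=
  (Real.sqrt 3)⁻¹ • (v (i + 1) - v (i + 2))

/-- The frame `(vᵢ, vᵢ^⊥, E)`. -/
def tripodFrame {d : ℕ} (v : Fin 3 → Mink (d + 2)) (E : Fin d → Mink (d + 2)) (i : Fin 3) :
    Fin (d + 2) → Mink (d + 2) :=
  Matrix.vecCons (v i) (Matrix.vecCons (perp v i) E)

/-- A framed tripod in the tangent bundle of `ℍⁿ`, `n = d + 2`: three unit vectors `v₀, v₁, v₂` at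
the same point with mutual angles `2π/3`, together with a positive orthonormal frame `E` of the
orthogonal complement of their plane, which is oriented by the cyclic order of the `vᵢ`. -/
structure FramedTripod (d : ℕ) where
  base : Mink (d + 2)
  v : Fin 3 → Mink (d + 2)
  E : Fin d → Mink (d + 2)
  base_mem : base ∈ hyp (d + 2)
  unit : ∀ i, IsUnitTangent base (v i)
  angle_eq : ∀ i j, i ≠ j → angle (v i) (v j) = 2 * Real.pi / 3
  frame : ∀ i, IsPosFrame base (tripodFrame v E i)

/-- The rotations `A` and `B` of Euclidean `m`-space are `ε`-close: the angle between `u` and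
`A⁻¹ B u` is at most `ε`, for every unit vector `u`. -/
def RotClose {m : ℕ} (ε : ℝ) (A B : Matrix (Fin m) (Fin m) ℝ) : Prop :=
  ∀ u : Fin m → ℝ, u ⬝ᵥ u = 1 → Real.arccos (u ⬝ᵥ ((A⁻¹ * B) *ᵥ u)) ≤ ε

/-- The frame obtained from `f` by negating its first two vectors. -/
def negFirstTwo {n : ℕ} (f : Fin n → Mink n) : Fin n → Mink n :=
  fun j => if (j : ℕ) < 2 then -f j else f j

/-- The matrix `diag(1, -1, -1, 1, …, 1)`. -/
def badMonodromy (m : ℕ) : Matrix (Fin m) (Fin m) ℝ :=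
  Matrix.diagonal fun j => if (j : ℕ) = 1 ∨ (j : ℕ) = 2 then -1 else 1

/-- `P` and `Q` are framed tripods `((v₀, v₁, v₂), E)` and `((u₀, u₁, u₂), F)` in `ℍⁿ`, `n = d + 2`,
and the geodesic segment from the base point of `P` to the image under the isometry `g` of the base
point of `Q` satisfies the conditions on the `i`-th connection of `(R, ε)`-connected framed tripods,
with monodromy `ε`-close to `U`. If `g` is a deck transformation of `M`, then the segment represents
a geodesic segment in `M` between the base points of the framed tripods in `M` that are the
images of `P` and `Q`. Here `w` is the initial velocity of the segment, and `l` its length. The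
`i`-th connection arrives along the leg `u₋ᵢ`. -/
def IsConnection {d : ℕ} (R ε : ℝ) (U : Matrix (Fin (d + 2)) (Fin (d + 2)) ℝ)
    (P Q : FramedTripod d) (g : Matrix.SpecialLinearGroup (Fin (d + 2 + 1)) ℝ) (i : Fin 3) : Prop :=
  ∃ (w : Mink (d + 2)) (l : ℝ),
    IsUnitTangent P.base w ∧ 0 < l ∧ geo P.base w l = g.1 *ᵥ Q.base ∧
    R + Real.log (4 / 3) - ε < l ∧ l < R + Real.log (4 / 3) + ε ∧
    angle (P.v i) w ≤ Real.exp (-(R / 4)) ∧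
    angle (g.1 *ᵥ Q.v (-i)) (-geoVel P.base w l) ≤ Real.exp (-(R / 4)) ∧
    ∃ X ∈ Matrix.specialOrthogonalGroup (Fin (d + 2)) ℝ,
      (∀ k, g.1 *ᵥ tripodFrame Q.v Q.E (-i) k =
        ∑ j, X j k •
          negFirstTwo (fun a => transport P.base w l (tripodFrame P.v P.E i a)) j) ∧
      RotClose ε X U

/-- The pants `ρ` in `M = Γ \ ℍⁿ` is generated by two framed tripods in `M` and three connections
`γ₀, γ₁, γ₂` between them that satisfy `IsConnection` with monodromies `ε`-close to `U`. The framed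
tripods are given by lifts `P, Q`, and the lift of `γᵢ` that starts at the base point of `P` ends at
the base point of `gᵢ Q`; so the homotopy class of the loop `γᵢ₊₁ γᵢ₋₁⁻¹` corresponds to the deck
transformation `gᵢ₊₁ gᵢ₋₁⁻¹`. These three loops determine the pants `ρ`: they agree with the images
of the cuffs, up to a common conjugation (change of base point). -/
def IsGenerated {d : ℕ} {Γ : Subgroup (Matrix.SpecialLinearGroup (Fin (d + 2 + 1)) ℝ)}
    (R ε : ℝ) (U : Matrix (Fin (d + 2)) (Fin (d + 2)) ℝ) (ρ : PantsGroup →* Γ) : Prop :=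
  ∃ (P Q : FramedTripod d) (g : Fin 3 → Γ) (h : Γ),
    (∀ i, IsConnection R ε U P Q (g i).1 i) ∧
    ∀ i, g (i + 1) * (g (i - 1))⁻¹ = h * ρ (cuff i) * h⁻¹

/-- `(R, ε)`-good pants: generated by well-connected framed tripods. -/
def IsGoodPants {d : ℕ} {Γ : Subgroup (Matrix.SpecialLinearGroup (Fin (d + 2 + 1)) ℝ)}
    (R ε : ℝ) (ρ : PantsGroup →* Γ) : Prop :=
  IsGenerated R ε 1 ρ

/-- `(R, ε)`-bad pants: generated by badly-connected framed tripods. -/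
def IsBadPants {d : ℕ} {Γ : Subgroup (Matrix.SpecialLinearGroup (Fin (d + 2 + 1)) ℝ)}
    (R ε : ℝ) (ρ : PantsGroup →* Γ) : Prop :=
  IsGenerated R ε (badMonodromy (d + 2)) ρ

end

end HypPants

open HypPants

/-!
The proof works in Minkowski space and follows the two ideal triangles of the pants that spin around
its cuffs.

Let `c i = ρ (cuff i)`, and let the null vector `V i` represent the attracting fixed point of `c i`.
In the free group no power of one cuff commutes with another one, and in a discrete group an isometry
that fixes the attracting fixed point of a hyperbolic element commutes with a power of it
(`exists_pow_commute`). So the three points are distinct, and the `V i` can be scaled to have pairwise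
products `-3 / 2`: they span an ideal triangle with barycenter `(V 0 + V 1 + V 2) / 3`
(`exists_isSpunTriangle`). The second ideal triangle has as its vertices the attracting fixed points
of `c 0`, `c 1` and `c 1 * c 2 * (c 1)⁻¹`; its images under `(c 1)⁻¹`, `c 0` and `1` are adjacent to
the first triangle along the three edges (`IsSpunTriangle.connector_opposite`). As `c i` scales `V i`
by `exp (l i)`, the shears along these edges are exactly `(l (i + 1) + l (i + 2) - l i) / 2`, hence
`3ε`-close to `R`. The tripods are placed at the barycenters of the triangles with legs pointing to
the vertices. The segment between the barycenters of adjacent triangles of large shear `T` has length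
`T + log (4 / 3)` up to `O (exp (-T))`, its directions at both ends agree with the legs up to
`O (exp (-T))`, and parallel transport along it is explicit (`IsEdge.exists_segment`,
`transvection_mulVec`).

It remains to compare frames. Let `e i` and `f i` be the unit normals of the `i`-th edge that point
into the two adjacent triangles. Modulo `V i`, the normals `e` of the two edges at the vertex `V i`
are opposite, and so are the normals `f` after one of them is moved by `c i`, which is `ε`-close to
the identity on the orthogonal complement of `V i` modulo `V i`. So a vector normal to the first
triangle has products with `f 0, f 1, f 2` that change sign, up to `ε`, from each edge to each other
edge. Three signs cannot alternate in this way, so that these products are `3ε / 2`-small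
(`IsSpunTriangle.form_oppositeNormal_sq_le`), and `f i` is close to `-e i` or to `e i`. This is the
dichotomy between good and bad pants. The second triangle, with its normal frame, is the image of the
first one under a product of an even number of reflections adapted to the last edge
(`exists_lorentz_of_isEdge`), which makes the frames close at this edge with the right orientation.
The monodromies of the cuffs carry this over to the other two edges
(`IsSpunTriangle.form_connector_sub_le`).
-/

namespace HypPants

/-! ### Algebra of the Lorentzian form -/

section Form

variable {n : ℕ}

theorem form_comm (x y : Mink n) : form x y = form y x := by
  simp only [form, mul_comm]

@[simp] theorem form_add_left (x y z : Mink n) : form (x + y) z = form x z + form y z := by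
  simp only [form, Pi.add_apply, add_mul, Finset.sum_add_distrib]; ring

@[simp] theorem form_smul_left (a : ℝ) (x z : Mink n) : form (a • x) z = a * form x z := by
  simp only [form, Pi.smul_apply, smul_eq_mul, mul_assoc, ← Finset.mul_sum]; ring

@[simp] theorem form_add_right (x y z : Mink n) : form z (x + y) = form z x + form z y := by
  rw [form_comm, form_add_left, form_comm x, form_comm y]

@[simp] theorem form_smul_right (a : ℝ) (x z : Mink n) : form z (a • x) = a * form z x := by
  rw [form_comm, form_smul_left, form_comm x]

@[simp] theorem form_neg_left (x z : Mink n) : form (-x) z = -form x z := by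
  rw [← neg_one_smul ℝ x, form_smul_left]; ring

@[simp] theorem form_neg_right (x z : Mink n) : form z (-x) = -form z x := by
  rw [form_comm, form_neg_left, form_comm x]

@[simp] theorem form_sub_left (x y z : Mink n) : form (x - y) z = form x z - form y z := by
  rw [sub_eq_add_neg, form_add_left, form_neg_left]; ring

@[simp] theorem form_sub_right (x y z : Mink n) : form z (x - y) = form z x - form z y := by
  rw [form_comm, form_sub_left, form_comm x, form_comm y]

@[simp] theorem form_zero_left (z : Mink n) : form 0 z = 0 := by
  rw [← zero_smul ℝ z, form_smul_left, zero_mul]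

@[simp] theorem form_zero_right (z : Mink n) : form z 0 = 0 := by
  rw [form_comm, form_zero_left]

theorem form_sum_left {ι : Type*} (s : Finset ι) (x : ι → Mink n) (z : Mink n) :
    form (∑ i ∈ s, x i) z = ∑ i ∈ s, form (x i) z := by
  classical
  induction s using Finset.induction_on with
  | empty => simp
  | insert a s ha ih => rw [Finset.sum_insert ha, Finset.sum_insert ha, form_add_left, ih]

theorem form_sum_right {ι : Type*} (s : Finset ι) (x : ι → Mink n) (z : Mink n) :
    form z (∑ i ∈ s, x i) = ∑ i ∈ s, form z (x i) := by
  simp only [form_comm z, form_sum_left]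

/-! ### Causal vectors -/

/-- Cauchy-Schwarz inequality for the spatial parts; `form x x + x 0 ^ 2` is the square of the length
of the spatial part of `x`. -/
theorem spatial_sq_mul_le (x y : Mink n) :
    (∑ i : Fin n, x i.succ * y i.succ) ^ 2 ≤ (form x x + x 0 ^ 2) * (form y y + y 0 ^ 2) := by
  have h := Finset.sum_mul_sq_le_sq_mul_sq Finset.univ (fun i : Fin n => x i.succ)
    (fun i => y i.succ)
  refine h.trans_eq ?_
  simp only [form]
  congr 1 <;> · rw [show ∀ a b : ℝ, -(a * a) + b + a ^ 2 = b by intros; ring]; simp only [sq]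

theorem form_self_add_sq_nonneg (x : Mink n) : 0 ≤ form x x + x 0 ^ 2 := by
  have : 0 ≤ ∑ i : Fin n, x i.succ * x i.succ := Finset.sum_nonneg fun i _ => mul_self_nonneg _
  simp only [form]
  linarith [sq (x 0)]

/-- The form is positive semidefinite on the orthogonal complement of a causal vector. -/
theorem form_self_nonneg {x v : Mink n} (hx : form x x ≤ 0) (hx0 : x 0 ≠ 0) (h : form x v = 0) :
    0 ≤ form v v := by
  have h1 := spatial_sq_mul_le x v
  have h2 : ∑ i : Fin n, x i.succ * v i.succ = x 0 * v 0 := by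
    simp only [form] at h; linarith
  have hx2 : 0 < x 0 ^ 2 := by positivity
  have hvv := form_self_add_sq_nonneg v
  rw [h2] at h1
  by_contra hneg
  push Not at hneg
  nlinarith [mul_nonneg (neg_nonneg.2 hx) hvv]

/-- The form is positive definite on the orthogonal complement of a timelike vector. -/
theorem eq_zero_of_form_self {x v : Mink n} (hx : form x x < 0) (h : form x v = 0)
    (hv : form v v = 0) : v = 0 := by
  have h1 := spatial_sq_mul_le x v
  have h2 : ∑ i : Fin n, x i.succ * v i.succ = x 0 * v 0 := by
    simp only [form] at h; linarith
  rw [h2, hv] at h1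
  have h0 : v 0 = 0 := by
    have : v 0 ^ 2 ≤ 0 := by nlinarith [sq_nonneg (v 0)]
    exact pow_eq_zero_iff (two_ne_zero) |>.1 (le_antisymm this (sq_nonneg _))
  have h3 : ∑ i : Fin n, v i.succ * v i.succ = 0 := by
    simp only [form, h0] at hv; linarith
  have h4 := (Finset.sum_eq_zero_iff_of_nonneg fun i _ => mul_self_nonneg _).1 h3
  ext i
  refine Fin.cases h0 (fun j => ?_) i
  simpa using h4 j (Finset.mem_univ _)

/-- Causal vectors of the future cone have nonpositive product. -/
theorem form_nonpos {x y : Mink n} (hx : form x x ≤ 0) (hy : form y y ≤ 0) (hx0 : 0 < x 0)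
    (hy0 : 0 < y 0) : form x y ≤ 0 := by
  have h1 := spatial_sq_mul_le x y
  have h2 : (∑ i : Fin n, x i.succ * y i.succ) ^ 2 ≤ (x 0 * y 0) ^ 2 := by
    rw [mul_pow]
    refine h1.trans ?_
    exact mul_le_mul (by linarith) (by linarith)
      (form_self_add_sq_nonneg y) (sq_nonneg _)
  have h3 : |∑ i : Fin n, x i.succ * y i.succ| ≤ x 0 * y 0 :=
    abs_le_of_sq_le_sq h2 (by positivity)
  have := (abs_le.1 h3).2
  simp only [form]
  linarith

/-- Orthogonal null vectors are proportional: the difference of the two sides is a null vector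
without time component. -/
theorem smul_eq_smul_of_form_eq_zero {x y : Mink n} (hx : form x x = 0) (hy : form y y = 0)
    (h : form x y = 0) : y 0 • x = x 0 • y := by
  have hz : form (y 0 • x - x 0 • y) (y 0 • x - x 0 • y) = 0 := by
    simp [hx, hy, h, form_comm y x]
  have hz0 : (y 0 • x - x 0 • y) 0 = 0 := by simp [mul_comm]
  have h3 : ∑ i : Fin n, (y 0 • x - x 0 • y) i.succ * (y 0 • x - x 0 • y) i.succ = 0 := by
    rw [form, hz0] at hz; linarith
  have h4 := (Finset.sum_eq_zero_iff_of_nonneg fun i _ => mul_self_nonneg _).1 h3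
  refine sub_eq_zero.1 ?_
  ext i
  refine Fin.cases hz0 (fun j => ?_) i
  simpa using h4 j (Finset.mem_univ _)

/-- A null vector that pairs negatively with a point of hyperbolic space is in the future cone. -/
theorem pos_of_form_neg {x N : Mink n} (hx : x ∈ hyp n) (hN : form N N ≤ 0) (h : form N x < 0) :
    0 < N 0 := by
  by_contra h0
  push Not at h0
  rcases h0.lt_or_eq with h0 | h0
  · have := form_nonpos (x := -N) (y := x) (by simpa using hN) (by rw [hx.1]; norm_num)
      (by simpa using h0) hx.2
    rw [form_neg_left] at this
    linarith
  · have h1 := spatial_sq_mul_le N x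
    have h2 : form N x = ∑ i : Fin n, N i.succ * x i.succ := by simp [form, h0]
    have h3 := form_self_add_sq_nonneg x
    rw [← h2, h0] at h1
    nlinarith

/-- Cauchy-Schwarz inequality on the orthogonal complement of a causal vector. -/
theorem form_sq_le {N x y : Mink n} (hN : form N N ≤ 0) (hN0 : N 0 ≠ 0) (hx : form N x = 0)
    (hy : form N y = 0) : form x y ^ 2 ≤ form x x * form y y := by
  have h : ∀ t : ℝ, 0 ≤ form y y * (t * t) + 2 * form x y * t + form x x := fun t => by
    have := form_self_nonneg (v := x + t • y) hN hN0 (by simp [hx, hy])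
    simp only [form_add_left, form_add_right, form_smul_left, form_smul_right,
      form_comm y x] at this
    linarith
  have := discrim_le_zero h
  rw [discrim] at this
  linarith

/-- Triangle inequality, in squared form. -/
theorem form_add_self_le {N x y : Mink n} (hN : form N N ≤ 0) (hN0 : N 0 ≠ 0) (hx : form N x = 0)
    (hy : form N y = 0) : form (x + y) (x + y) ≤ 2 * form x x + 2 * form y y := by
  have := form_self_nonneg (v := x - y) hN hN0 (by simp [hx, hy])
  simp only [form_sub_left, form_sub_right, form_add_left, form_add_right,
    form_comm y x] at this ⊢
  linarith

theorem form_add_add_self_le {N x y z : Mink n} (hN : form N N ≤ 0) (hN0 : N 0 ≠ 0)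
    (hx : form N x = 0) (hy : form N y = 0) (hz : form N z = 0) :
    form (x + y + z) (x + y + z) ≤ 3 * form x x + 3 * form y y + 3 * form z z := by
  have h1 := form_self_nonneg (v := x - y) hN hN0 (by simp [hx, hy])
  have h2 := form_self_nonneg (v := x - z) hN hN0 (by simp [hx, hz])
  have h3 := form_self_nonneg (v := y - z) hN hN0 (by simp [hy, hz])
  simp only [form_sub_left, form_sub_right, form_add_left, form_add_right,
    form_comm y x, form_comm z x, form_comm z y] at h1 h2 h3 ⊢
  linarith

/-! ### Lorentz transformations and reflections -/

/-- The matrix `M` preserves the Lorentzian form. -/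
def IsLorentz (M : Matrix (Fin (n + 1)) (Fin (n + 1)) ℝ) : Prop :=
  ∀ x y : Mink n, form (M *ᵥ x) (M *ᵥ y) = form x y

theorem IsLorentz.mul {M N : Matrix (Fin (n + 1)) (Fin (n + 1)) ℝ} (hM : IsLorentz M)
    (hN : IsLorentz N) : IsLorentz (M * N) := fun x y => by
  rw [← Matrix.mulVec_mulVec, ← Matrix.mulVec_mulVec, hM, hN]

/-- The reflection of Minkowski space in the hyperplane orthogonal to `c`, for `form c c ≠ 0`. It is
written as a rank one perturbation of the identity, whose determinant is known. -/
noncomputable def reflection (c : Mink n) : Matrix (Fin (n + 1)) (Fin (n + 1)) ℝ :=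
  1 + Matrix.replicateCol Unit (-(2 / form c c) • c) *
    Matrix.replicateRow Unit (Fin.cons (-c 0) (fun i => c i.succ) : Fin (n + 1) → ℝ)

/-- Lowering the index: changing the sign of the time component turns the dot product into the
form. -/
theorem lower_dotProduct (c x : Mink n) :
    (Fin.cons (-c 0) (fun i => c i.succ) : Fin (n + 1) → ℝ) ⬝ᵥ x = form c x := by
  simp [dotProduct, Fin.sum_univ_succ, form]

theorem reflection_mulVec (c x : Mink n) :
    reflection c *ᵥ x = x - (2 * form c x / form c c) • c := by
  rw [reflection, Matrix.add_mulVec, Matrix.one_mulVec, ← Matrix.mulVec_mulVec]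
  ext i
  have : (Matrix.replicateRow Unit (Fin.cons (-c 0) (fun i => c i.succ) : Fin (n + 1) → ℝ)) *ᵥ x =
      fun _ => form c x := by
    ext j
    exact lower_dotProduct c x
  rw [this]
  simp [Matrix.mulVec, dotProduct]
  ring

theorem det_reflection {c : Mink n} (hc : form c c ≠ 0) : (reflection c).det = -1 := by
  rw [reflection, Matrix.det_one_add_replicateCol_mul_replicateRow, dotProduct_smul,
    lower_dotProduct, smul_eq_mul]
  field_simp
  norm_num

theorem isLorentz_reflection {c : Mink n} (hc : form c c ≠ 0) : IsLorentz (reflection c) :=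
  fun x y => by
    rw [reflection_mulVec, reflection_mulVec]
    simp only [form_sub_left, form_sub_right, form_smul_left, form_smul_right, form_comm x c]
    field_simp
    ring

theorem reflection_of_orthogonal {c x : Mink n} (h : form c x = 0) : reflection c *ᵥ x = x := by
  simp [reflection_mulVec, h]

theorem reflection_self {c : Mink n} (h : form c c ≠ 0) : reflection c *ᵥ c = -c := by
  rw [reflection_mulVec, mul_div_cancel_right₀ _ h, two_smul]
  abel

/-- The reflection in the perpendicular bisector of two vectors of the same norm swaps them. -/
theorem reflection_sub {a b : Mink n} (hab : form a a = form b b) (h : form (a - b) (a - b) ≠ 0) :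
    reflection (a - b) *ᵥ a = b := by
  have : 2 * form (a - b) a = form (a - b) (a - b) := by
    simp only [form_sub_left, form_sub_right, form_comm b a, hab]; ring
  rw [reflection_mulVec, this, div_self h, one_smul, sub_sub_cancel]

theorem reflection_sub' {a b : Mink n} (hab : form a a = form b b)
    (h : form (a - b) (a - b) ≠ 0) : reflection (a - b) *ᵥ b = a := by
  have h3 := reflection_self h
  rw [Matrix.mulVec_sub, reflection_sub hab h] at h3
  rw [← sub_right_inj (a := b), h3]
  abel

end Form

/-! ### Positive frames -/

section Frame

variable {n : ℕ}

theorem IsPosFrame.map {x : Mink n} {f : Fin n → Mink n} (hf : IsPosFrame x f)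
    {M : Matrix (Fin (n + 1)) (Fin (n + 1)) ℝ} (hM : IsLorentz M) (hdet : 0 < M.det)
    (hx : M *ᵥ x ∈ hyp n) : IsPosFrame (M *ᵥ x) (fun i => M *ᵥ f i) where
  base := hx
  tangent i := by rw [hM]; exact hf.tangent i
  orthonormal i j := by rw [hM]; exact hf.orthonormal i j
  positive := by
    have : Matrix.of (Matrix.vecCons (M *ᵥ x) (fun i => M *ᵥ f i)) =
        Matrix.of (Matrix.vecCons x f) * Mᵀ := by
      ext i j
      refine Fin.cases ?_ (fun k => ?_) i <;>
        simp [Matrix.mul_apply, Matrix.mulVec, dotProduct, mul_comm]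
    rw [this, Matrix.det_mul, Matrix.det_transpose]
    exact mul_pos hf.positive hdet

/-- Expansion of a vector in a Lorentz orthonormal basis. The difference of the two sides is
orthogonal to the basis. -/
theorem IsPosFrame.expansion {q : Mink n} {A : Fin n → Mink n} (hA : IsPosFrame q A)
    (x : Mink n) : x = -form q x • q + ∑ j, form (A j) x • A j := by
  set y := x - (-form q x • q + ∑ j, form (A j) x • A j) with hy
  have hq : form q y = 0 := by
    rw [hy, form_sub_right, form_add_right, form_smul_right, hA.base.1, form_sum_right]
    simp [hA.tangent]
  have hj : ∀ j, form (A j) y = 0 := fun j => by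
    rw [hy, form_sub_right, form_add_right, form_smul_right, form_comm _ q, hA.tangent,
      form_sum_right]
    simp [hA.orthonormal]
  have hlow : ∀ z : Mink n, z ⬝ᵥ (Fin.cons (-y 0) (fun i => y i.succ) : Fin (n + 1) → ℝ) =
      form z y := fun z => by rw [dotProduct_comm, lower_dotProduct, form_comm]
  have h0 : (Fin.cons (-y 0) (fun i => y i.succ) : Fin (n + 1) → ℝ) = 0 := by
    refine Matrix.eq_zero_of_mulVec_eq_zero hA.positive.ne' ?_
    ext i
    refine Fin.cases ?_ (fun k => ?_) i
    · exact (hlow q).trans hq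
    · exact (hlow (A k)).trans (hj k)
  have hy0 : y = 0 := by
    ext i
    refine Fin.cases ?_ (fun k => ?_) i
    · simpa using congrFun h0 0
    · simpa using congrFun h0 k.succ
  exact sub_eq_zero.1 hy0

theorem det_cons_one_zero (X : Matrix (Fin n) (Fin n) ℝ) :
    Matrix.det (Matrix.of (Matrix.vecCons (Matrix.vecCons 1 0 : Fin (n + 1) → ℝ)
      (fun k => (Matrix.vecCons 0 (X k) : Fin (n + 1) → ℝ)))) = X.det := by
  rw [Matrix.det_succ_row_zero, Fin.sum_univ_succ]
  simp
  rfl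

/-- The transition matrix between two positive frames at the same point is a rotation. -/
theorem IsPosFrame.exists_rotation {q : Mink n} {A B : Fin n → Mink n} (hA : IsPosFrame q A)
    (hB : IsPosFrame q B) : ∃ X ∈ Matrix.specialOrthogonalGroup (Fin n) ℝ,
      (∀ j k, X j k = form (A j) (B k)) ∧ ∀ k, B k = ∑ j, X j k • A j := by
  have hexp : ∀ k, B k = ∑ j, form (A j) (B k) • A j := fun k => by
    conv_lhs => rw [hA.expansion (B k), hB.tangent k]
    simp
  set X : Matrix (Fin n) (Fin n) ℝ := Matrix.of fun j k => form (A j) (B k) with hX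
  have hXX : Xᵀ * X = 1 := by
    ext k l
    rw [Matrix.mul_apply, Matrix.one_apply, ← hB.orthonormal k l]
    conv_rhs => rw [hexp l, form_sum_right]
    refine Finset.sum_congr rfl fun j _ => ?_
    simp [hX, form_comm (B k)]
    ring
  have hprod : Matrix.of (Matrix.vecCons q B) =
      Matrix.of (Matrix.vecCons (Matrix.vecCons 1 0 : Fin (n + 1) → ℝ)
      (fun k => (Matrix.vecCons 0 (Xᵀ k) : Fin (n + 1) → ℝ))) * Matrix.of (Matrix.vecCons q A) := by
    ext i j
    refine Fin.cases ?_ (fun k => ?_) i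
    · simp [Matrix.mul_apply, Fin.sum_univ_succ]
    · rw [Matrix.mul_apply, Fin.sum_univ_succ]
      have := congrFun (hexp k) j
      simpa [Finset.sum_apply, hX] using this
  have hdet : 0 < X.det := by
    have h := hB.positive
    rw [hprod, Matrix.det_mul, det_cons_one_zero, Matrix.det_transpose] at h
    exact pos_of_mul_pos_left h hA.positive.le
  have hdet1 : X.det = 1 := by
    have h := congrArg Matrix.det hXX
    rw [Matrix.det_mul, Matrix.det_transpose, Matrix.det_one] at h
    nlinarith
  refine ⟨X, ?_, fun j k => rfl, hexp⟩
  rw [Matrix.mem_specialOrthogonalGroup_iff, Matrix.mem_orthogonalGroup_iff']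
  exact ⟨by simpa [Matrix.star_eq_conjTranspose] using hXX, hdet1⟩

/-- An angle is bounded by its versine. For `δ ≥ π` there is nothing to show, as `arccos` takes
values in `[0, π]`. -/
theorem arccos_le_of_le {x δ : ℝ} (hδ : 0 ≤ δ) (h : 1 - 2 / Real.pi ^ 2 * δ ^ 2 ≤ x) :
    Real.arccos x ≤ δ := by
  rcases le_or_gt Real.pi δ with hδ' | hδ'
  · exact (Real.arccos_le_pi x).trans hδ'
  · rw [← Real.arccos_cos hδ hδ'.le]
    refine Real.arccos_le_arccos ?_
    refine (Real.cos_le_one_sub_mul_cos_sq ?_).trans h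
    rw [abs_of_nonneg hδ]
    exact hδ'.le

/-- If vectors with the same coordinates in two frames, up to signs `s`, are within `6ε` of each other,
then the rotation between the frames is `10ε`-close to the diagonal matrix of the signs. -/
theorem rotClose_diagonal {q : Mink n} {A B : Fin n → Mink n} (hA : IsPosFrame q A)
    (hB : IsPosFrame q B) {X : Matrix (Fin n) (Fin n) ℝ}
    (hX : X ∈ Matrix.specialOrthogonalGroup (Fin n) ℝ) (hXAB : ∀ j k, X j k = form (A j) (B k))
    (s : Fin n → ℝ) (hs : ∀ j, s j ^ 2 = 1) {ε : ℝ} (hε : 0 < ε)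
    (h : ∀ u : Fin n → ℝ, ∑ k, u k ^ 2 = 1 →
      form (∑ k, u k • (B k - s k • A k)) (∑ k, u k • (B k - s k • A k)) ≤ 36 * ε ^ 2) :
    RotClose (10 * ε) X (Matrix.diagonal s) := by
  intro u hu
  have hu1 : ∑ k, u k ^ 2 = 1 := by rw [← hu]; simp [dotProduct, sq]
  have hXX : Xᵀ * X = 1 := by
    rw [Matrix.mem_specialOrthogonalGroup_iff, Matrix.mem_orthogonalGroup_iff'] at hX
    simpa [Matrix.star_eq_conjTranspose] using hX.1
  have hBB : form (∑ k, u k • B k) (∑ k, u k • B k) = 1 := by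
    rw [← hu1]
    simp only [form_sum_left, form_sum_right, form_smul_left, form_smul_right, hB.orthonormal]
    simp [sq]
  have hAA : form (∑ k, (u k * s k) • A k) (∑ k, (u k * s k) • A k) = 1 := by
    rw [← hu1]
    simp only [form_sum_left, form_sum_right, form_smul_left, form_smul_right, hA.orthonormal]
    simp only [mul_ite, mul_one, mul_zero, Finset.sum_ite_eq', Finset.mem_univ, if_true]
    refine Finset.sum_congr rfl fun k _ => ?_
    linear_combination u k ^ 2 * hs k
  have hAB : u ⬝ᵥ ((X⁻¹ * Matrix.diagonal s) *ᵥ u) =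
      form (∑ k, (u k * s k) • A k) (∑ k, u k • B k) := by
    rw [Matrix.inv_eq_left_inv hXX]
    simp only [form_sum_left, form_sum_right, form_smul_left, form_smul_right, dotProduct,
      Matrix.mulVec, Matrix.mul_diagonal, Matrix.transpose_apply, hXAB, Finset.mul_sum]
    refine Finset.sum_congr rfl fun j _ => Finset.sum_congr rfl fun k _ => ?_
    ring
  have hdiff : ∑ k, u k • (B k - s k • A k) = ∑ k, u k • B k - ∑ k, (u k * s k) • A k := by
    rw [← Finset.sum_sub_distrib]
    refine Finset.sum_congr rfl fun k _ => ?_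
    rw [smul_sub, smul_smul]
  have h1 := h u hu1
  rw [hdiff] at h1
  simp only [form_sub_left, form_sub_right, hAA, hBB, form_comm (∑ k, u k • B k)] at h1
  rw [hAB]
  refine arccos_le_of_le (by positivity) ?_
  have hpi : Real.pi ^ 2 ≤ 10 := by nlinarith [Real.pi_lt_d2, Real.pi_pos]
  have : 18 * ε ^ 2 ≤ 2 / Real.pi ^ 2 * (10 * ε) ^ 2 := by
    rw [div_mul_eq_mul_div, le_div_iff₀ (by positivity)]
    nlinarith [sq_nonneg ε]
  linarith

/-! ### Construction of framed tripods -/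

/-- A reflection or the identity carrying `a` to `b`, for tangent vectors of the same length. -/
theorem exists_lorentz_map_eq {p a b : Mink n} (hp : p ∈ hyp n) (ha : form p a = 0)
    (hb : form p b = 0) (hab : form a a = form b b) :
    ∃ S : Matrix (Fin (n + 1)) (Fin (n + 1)) ℝ, IsLorentz S ∧ (S.det = 1 ∨ S.det = -1) ∧
      S *ᵥ a = b ∧ ∀ x, form x a = form x b → S *ᵥ x = x := by
  by_cases h : form (a - b) (a - b) = 0
  · have h0 := eq_zero_of_form_self (x := p) (by rw [hp.1]; norm_num) (by simp [ha, hb]) h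
    exact ⟨1, fun x y => by simp, by simp, by simpa using sub_eq_zero.1 h0, by simp⟩
  · refine ⟨reflection (a - b), isLorentz_reflection h, Or.inr (det_reflection h),
      reflection_sub hab h, fun x hx => reflection_of_orthogonal ?_⟩
    rw [form_sub_left, form_comm a, form_comm b, hx, sub_self]

theorem form_single (i j : Fin (n + 1)) :
    form (Pi.single i 1 : Mink n) (Pi.single j 1) =
      if i = j then (if i = 0 then -1 else 1) else 0 := by
  refine Fin.cases ?_ (fun k => ?_) i <;> refine Fin.cases ?_ (fun l => ?_) j <;>
    simp [form, Pi.single_apply, Fin.succ_ne_zero, (Fin.succ_ne_zero _).symm, eq_comm]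

theorem isPosFrame_single :
    IsPosFrame (Pi.single 0 1 : Mink n) (fun i => Pi.single i.succ 1) where
  base := ⟨by simp [form_single], by simp⟩
  tangent i := by simp [form_single, (Fin.succ_ne_zero _).symm]
  orthonormal i j := by simp [form_single, Fin.succ_ne_zero]
  positive := by
    have : Matrix.of (Matrix.vecCons (Pi.single 0 1 : Mink n)
        (fun i => Pi.single i.succ 1)) = 1 := by
      ext i j
      refine Fin.cases ?_ (fun k => ?_) i <;>
        simp [Matrix.one_apply, Pi.single_apply, eq_comm]
    rw [this, Matrix.det_one]
    exact one_pos

/-- The origin of the hyperboloid is carried to any other point by a reflection or the identity. -/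
theorem exists_lorentz_single_zero {p : Mink n} (hp : p ∈ hyp n) :
    ∃ S : Matrix (Fin (n + 1)) (Fin (n + 1)) ℝ, IsLorentz S ∧ (S.det = 1 ∨ S.det = -1) ∧
      S *ᵥ Pi.single 0 1 = p := by
  have h0 : form (Pi.single 0 1 : Mink n) (Pi.single 0 1) = -1 := by simp [form_single]
  by_cases h : form (Pi.single 0 1 - p) (Pi.single 0 1 - p) = 0
  · have h1 : form (Pi.single 0 1) (Pi.single 0 1 - p) = 0 := by
      simp only [form_sub_left, form_sub_right, h0, hp.1, form_comm p] at h ⊢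
      linarith
    have h2 := eq_zero_of_form_self (by rw [h0]; norm_num) h1 h
    exact ⟨1, fun x y => by simp, by simp, by rw [Matrix.one_mulVec]; exact sub_eq_zero.1 h2⟩
  · exact ⟨_, isLorentz_reflection h, Or.inr (det_reflection h),
      reflection_sub (h0.trans hp.1.symm) h⟩

end Frame

section Tripod

variable {d : ℕ}

/-- A point and two orthonormal tangent vectors extend to a positive frame. -/
theorem exists_isPosFrame (hd : 1 ≤ d) {p v v' : Mink (d + 2)} (hp : p ∈ hyp (d + 2))
    (hv : IsUnitTangent p v) (hv' : IsUnitTangent p v') (hvv' : form v v' = 0) :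
    ∃ E : Fin d → Mink (d + 2), IsPosFrame p (Matrix.vecCons v (Matrix.vecCons v' E)) := by
  obtain ⟨S₀, hS₀, hdet₀, h0⟩ := exists_lorentz_single_zero hp
  obtain ⟨S₁, hS₁, hdet₁, h1, hfix₁⟩ := exists_lorentz_map_eq (p := p)
    (a := S₀ *ᵥ Pi.single ⟨1, by omega⟩ 1) (b := v) hp
    (by rw [← h0, hS₀]; simp [form_single]) hv.1 (by rw [hS₀, hv.2]; simp [form_single])
  have hp1 : S₁ *ᵥ p = p := hfix₁ p (by rw [hv.1, ← h0, hS₀]; simp [form_single])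
  obtain ⟨S₂, hS₂, hdet₂, h2, hfix₂⟩ := exists_lorentz_map_eq (p := p)
    (a := S₁ *ᵥ (S₀ *ᵥ Pi.single ⟨2, by omega⟩ 1)) (b := v') hp
    (by rw [← hp1, hS₁, ← h0, hS₀]; simp [form_single, Fin.ext_iff]) hv'.1
    (by rw [hS₁, hS₀, hv'.2]; simp [form_single, Fin.ext_iff])
  have hp2 : S₂ *ᵥ p = p := hfix₂ p (by
    rw [hv'.1, ← hp1, hS₁, ← h0, hS₀]; simp [form_single, Fin.ext_iff])
  have hv2 : S₂ *ᵥ v = v := hfix₂ v (by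
    rw [hvv', ← h1, hS₁, hS₀]; simp [form_single, Fin.ext_iff])
  have key : ∃ M : Matrix (Fin (d + 2 + 1)) (Fin (d + 2 + 1)) ℝ, IsLorentz M ∧ 0 < M.det ∧
      M *ᵥ Pi.single 0 1 = p ∧ M *ᵥ Pi.single ⟨1, by omega⟩ 1 = v ∧
        M *ᵥ Pi.single ⟨2, by omega⟩ 1 = v' := by
    have hM : IsLorentz (S₂ * (S₁ * S₀)) := hS₂.mul (hS₁.mul hS₀)
    have hM0 : (S₂ * (S₁ * S₀)) *ᵥ Pi.single 0 1 = p := by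
      rw [← Matrix.mulVec_mulVec, ← Matrix.mulVec_mulVec, h0, hp1, hp2]
    have hM1 : (S₂ * (S₁ * S₀)) *ᵥ Pi.single ⟨1, by omega⟩ 1 = v := by
      rw [← Matrix.mulVec_mulVec, ← Matrix.mulVec_mulVec, h1, hv2]
    have hM2 : (S₂ * (S₁ * S₀)) *ᵥ Pi.single ⟨2, by omega⟩ 1 = v' := by
      rw [← Matrix.mulVec_mulVec, ← Matrix.mulVec_mulVec, h2]
    have hdet : (S₂ * (S₁ * S₀)).det = 1 ∨ (S₂ * (S₁ * S₀)).det = -1 := by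
      rw [Matrix.det_mul, Matrix.det_mul]
      rcases hdet₀ with h | h <;> rcases hdet₁ with h' | h' <;> rcases hdet₂ with h'' | h'' <;>
        simp [h, h', h'']
    rcases hdet with hdet | hdet
    · exact ⟨_, hM, by rw [hdet]; exact one_pos, hM0, hM1, hM2⟩
    · -- There is room for a reflection that fixes the first three basis vectors, as `1 ≤ d`.
      let k : Fin (d + 2 + 1) := ⟨3, by omega⟩
      have hk : form (Pi.single k 1 : Mink (d + 2)) (Pi.single k 1) ≠ 0 := by
        simp [form_single, k, Fin.ext_iff]
      have hfix : ∀ j : Fin (d + 2 + 1), j ≠ k →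
          reflection (Pi.single k 1) *ᵥ Pi.single j 1 = Pi.single j 1 := fun j hj =>
        reflection_of_orthogonal (by simp [form_single, hj.symm])
      refine ⟨_, hM.mul (isLorentz_reflection hk), ?_, ?_, ?_, ?_⟩
      · rw [Matrix.det_mul, hdet, det_reflection hk]; norm_num
      · rw [← Matrix.mulVec_mulVec, hfix _ (by simp [k, Fin.ext_iff]), hM0]
      · rw [← Matrix.mulVec_mulVec, hfix _ (by simp [k, Fin.ext_iff]), hM1]
      · rw [← Matrix.mulVec_mulVec, hfix _ (by simp [k, Fin.ext_iff]), hM2]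
  obtain ⟨M, hM, hdet, hM0, hM1, hM2⟩ := key
  refine ⟨fun k => M *ᵥ Pi.single k.succ.succ.succ 1, ?_⟩
  have := isPosFrame_single.map hM hdet (by rwa [hM0])
  rw [hM0] at this
  convert this using 1
  funext i
  refine Fin.cases hM1.symm (fun i => ?_) i
  exact Fin.cases hM2.symm (fun _ => rfl) i

theorem perp_isUnitTangent {n : ℕ} {p : Mink n} {v : Fin 3 → Mink n}
    (hv : ∀ i, IsUnitTangent p (v i)) (hvv : ∀ i j, i ≠ j → form (v i) (v j) = -1 / 2)
    (i : Fin 3) : IsUnitTangent p (perp v i) ∧ form (v i) (perp v i) = 0 := by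
  have h12 : i + 1 ≠ i + 2 := (by decide : ∀ i : Fin 3, i + 1 ≠ i + 2) i
  have h01 : i ≠ i + 1 := (by decide : ∀ i : Fin 3, i ≠ i + 1) i
  have h02 : i ≠ i + 2 := (by decide : ∀ i : Fin 3, i ≠ i + 2) i
  have h3 : (Real.sqrt 3)⁻¹ * (Real.sqrt 3)⁻¹ = 1 / 3 := by
    rw [← mul_inv, Real.mul_self_sqrt (by norm_num)]; norm_num
  refine ⟨⟨by simp [perp, (hv _).1], ?_⟩, by simp [perp, hvv _ _ h01, hvv _ _ h02]⟩
  simp only [perp, form_smul_left, form_smul_right, form_sub_left, form_sub_right, (hv _).2,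
    hvv _ _ h12, hvv _ _ h12.symm]
  linear_combination 3 * h3

/-- The frames of a tripod at its three legs differ by a rotation of its plane. -/
theorem isPosFrame_tripodFrame_succ {p : Mink (d + 2)} {v : Fin 3 → Mink (d + 2)}
    {E : Fin d → Mink (d + 2)} (hv : ∀ i, IsUnitTangent p (v i))
    (hvv : ∀ i j, i ≠ j → form (v i) (v j) = -1 / 2) (hsum : v 0 + v 1 + v 2 = 0) {i : Fin 3}
    (h : IsPosFrame p (tripodFrame v E i)) : IsPosFrame p (tripodFrame v E (i + 1)) := by
  have h12 : i + 1 ≠ i + 2 := (by decide : ∀ i : Fin 3, i + 1 ≠ i + 2) i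
  have h01 : i ≠ i + 1 := (by decide : ∀ i : Fin 3, i ≠ i + 1) i
  have h02 : i ≠ i + 2 := (by decide : ∀ i : Fin 3, i ≠ i + 2) i
  have e1 : i + 1 + 1 = i + 2 := (by decide : ∀ i : Fin 3, i + 1 + 1 = i + 2) i
  have e2 : i + 1 + 2 = i := (by decide : ∀ i : Fin 3, i + 1 + 2 = i) i
  have hs : v i + v (i + 1) + v (i + 2) = 0 := by
    rw [← hsum]
    fin_cases i <;> simp <;> abel
  have norm : ∀ j k, j ≠ k → form (v j - v k) (v j - v k) = 3 := fun j k hjk => by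
    simp only [form_sub_left, form_sub_right, (hv _).2, hvv _ _ hjk, hvv _ _ hjk.symm]; norm_num
  have hE : ∀ j k, form (v j) (E k) = 0 := fun j k => by
    have h0 : form (v i) (E k) = 0 := by
      simpa [tripodFrame, (Fin.succ_ne_zero _).symm] using h.orthonormal 0 k.succ.succ
    have h1 : form (perp v i) (E k) = 0 := by
      simpa [tripodFrame, Fin.ext_iff] using h.orthonormal 1 k.succ.succ
    have h2 : form (v (i + 1)) (E k) - form (v (i + 2)) (E k) = 0 := by
      simpa [perp] using h1
    have h3 : form (v i) (E k) + form (v (i + 1)) (E k) + form (v (i + 2)) (E k) = 0 := by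
      rw [← form_add_left, ← form_add_left, hs, form_zero_left]
    rcases (by decide : ∀ i j : Fin 3, j = i ∨ j = i + 1 ∨ j = i + 2) i j with rfl | rfl | rfl <;>
      linarith
  have hA : form (v i - v (i + 1)) (v i - v (i + 1)) ≠ 0 := by rw [norm _ _ h01]; norm_num
  have hB : form (v (i + 1) - v (i + 2)) (v (i + 1) - v (i + 2)) ≠ 0 := by
    rw [norm _ _ h12]; norm_num
  have huu : ∀ j k, form (v j) (v j) = form (v k) (v k) := fun j k => by rw [(hv j).2, (hv k).2]
  set M := reflection (v i - v (i + 1)) * reflection (v (i + 1) - v (i + 2)) with hM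
  have M0 : M *ᵥ v i = v (i + 1) := by
    rw [hM, ← Matrix.mulVec_mulVec, reflection_of_orthogonal (x := v i),
      reflection_sub (huu _ _) hA]
    simp [hvv _ _ h01.symm, hvv _ _ h02.symm]
  have M1 : M *ᵥ v (i + 1) = v (i + 2) := by
    rw [hM, ← Matrix.mulVec_mulVec, reflection_sub (huu _ _) hB, reflection_of_orthogonal]
    simp [hvv _ _ h02, hvv _ _ h12]
  have M2 : M *ᵥ v (i + 2) = v i := by
    rw [hM, ← Matrix.mulVec_mulVec, reflection_sub' (huu _ _) hB, reflection_sub' (huu _ _) hA]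
  have Mp : M *ᵥ p = p := by
    rw [hM, ← Matrix.mulVec_mulVec, reflection_of_orthogonal (x := p),
      reflection_of_orthogonal (x := p)] <;> simp [form_comm _ p, (hv _).1]
  have ME : ∀ k, M *ᵥ E k = E k := fun k => by
    rw [hM, ← Matrix.mulVec_mulVec, reflection_of_orthogonal (x := E k),
      reflection_of_orthogonal (x := E k)] <;> simp [hE]
  have := h.map (M := M) ((isLorentz_reflection hA).mul (isLorentz_reflection hB))
    (by rw [hM, Matrix.det_mul, det_reflection hA, det_reflection hB]; norm_num)
    (by rw [Mp]; exact h.base)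
  rw [Mp] at this
  convert this using 1
  funext k
  refine Fin.cases M0.symm (fun k => Fin.cases ?_ (fun k => (ME k).symm) k) k
  simp [tripodFrame, perp, e1, e2, Matrix.mulVec_smul, Matrix.mulVec_sub, M1, M2]

theorem angle_eq_two_pi_div_three {n : ℕ} {v w : Mink n} (h : form v w = -1 / 2) :
    angle v w = 2 * Real.pi / 3 := by
  have hc : Real.cos (2 * Real.pi / 3) = -1 / 2 := by
    rw [show 2 * Real.pi / 3 = Real.pi - Real.pi / 3 by ring, Real.cos_pi_sub,
      Real.cos_pi_div_three]
    norm_num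
  rw [angle, h, ← hc, Real.arccos_cos] <;> linarith [Real.pi_pos]

/-- A tripod can be framed. -/
theorem exists_framedTripod (hd : 1 ≤ d) {p : Mink (d + 2)} {v : Fin 3 → Mink (d + 2)}
    (hp : p ∈ hyp (d + 2)) (hv : ∀ i, IsUnitTangent p (v i))
    (hvv : ∀ i j, i ≠ j → form (v i) (v j) = -1 / 2) (hsum : v 0 + v 1 + v 2 = 0) :
    ∃ P : FramedTripod d, P.base = p ∧ P.v = v := by
  obtain ⟨E, hE⟩ := exists_isPosFrame hd hp (hv 0) (perp_isUnitTangent hv hvv 0).1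
    (perp_isUnitTangent hv hvv 0).2
  have h0 : IsPosFrame p (tripodFrame v E 0) := hE
  have h1 := isPosFrame_tripodFrame_succ hv hvv hsum h0
  have h2 := isPosFrame_tripodFrame_succ hv hvv hsum h1
  exact ⟨⟨p, v, E, hp, hv, fun i j hij => angle_eq_two_pi_div_three (hvv i j hij), fun i => by
    fin_cases i; exacts [h0, h1, h2]⟩, rfl, rfl⟩

/-- The image of a framed tripod under an orientation preserving isometry, with the legs
renumbered cyclically. -/
noncomputable def FramedTripod.shiftedMap (P : FramedTripod d)
    (L : Matrix (Fin (d + 2 + 1)) (Fin (d + 2 + 1)) ℝ) (hL : IsLorentz L) (hdet : 0 < L.det)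
    (hbase : L *ᵥ P.base ∈ hyp (d + 2)) : FramedTripod d where
  base := L *ᵥ P.base
  v i := L *ᵥ P.v (i + 1)
  E k := L *ᵥ P.E k
  base_mem := hbase
  unit i := ⟨by rw [hL]; exact (P.unit _).1, by rw [hL]; exact (P.unit _).2⟩
  angle_eq i j hij := by
    rw [angle, hL]
    exact P.angle_eq _ _ (by simpa using hij)
  frame i := by
    convert (P.frame (i + 1)).map hL hdet hbase using 1
    funext k
    refine Fin.cases rfl (fun k => Fin.cases ?_ (fun k => rfl) k) k
    simp [tripodFrame, perp, Matrix.mulVec_smul, Matrix.mulVec_sub, add_right_comm i 2 1]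

end Tripod

/-! ### Two ideal triangles with a common edge -/

section Edge

variable {n : ℕ}

/-- Null vectors `X`, `Y`, spanning an ideal edge, and unit vectors `e`, `f` normal to the edge.
The ideal triangles adjacent to the edge have the remaining vertices `X + Y + √3 e` and
`exp T X + exp (-T) Y + √3 f`, where `T` is the shear along the edge. -/
structure IsEdge (X Y e f : Mink n) : Prop where
  XX : form X X = 0
  YY : form Y Y = 0
  XY : form X Y = -3 / 2
  Xe : form X e = 0
  Ye : form Y e = 0
  Xf : form X f = 0
  Yf : form Y f = 0
  ee : form e e = 1
  ff : form f f = 1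

/-- The barycenter of the ideal triangle with vertices `exp T X`, `exp (-T) Y` and
`exp T X + exp (-T) Y + √3 e`. -/
noncomputable def barycenter (X Y e : Mink n) (T : ℝ) : Mink n :=
  (1 / 3 : ℝ) • ((2 * Real.exp T) • X + (2 * Real.exp (-T)) • Y + Real.sqrt 3 • e)

theorem IsEdge.symm {X Y e f : Mink n} (h : IsEdge X Y e f) : IsEdge X Y f e :=
  ⟨h.XX, h.YY, h.XY, h.Xf, h.Yf, h.Xe, h.Ye, h.ff, h.ee⟩

theorem IsEdge.form_barycenter_X {X Y e f : Mink n} (h : IsEdge X Y e f) (T : ℝ) :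
    form X (barycenter X Y e T) = -Real.exp (-T) := by
  simp only [barycenter, form_smul_right, form_add_right, h.XX, h.XY, h.Xe]; ring

theorem IsEdge.form_barycenter_Y {X Y e f : Mink n} (h : IsEdge X Y e f) (T : ℝ) :
    form Y (barycenter X Y e T) = -Real.exp T := by
  simp only [barycenter, form_smul_right, form_add_right, h.YY, form_comm Y X, h.XY, h.Ye]; ring

theorem IsEdge.form_barycenter_self {X Y e f : Mink n} (h : IsEdge X Y e f) (T : ℝ) :
    form e (barycenter X Y e T) = Real.sqrt 3 / 3 := by
  simp only [barycenter, form_smul_right, form_add_right, form_comm e X, form_comm e Y, h.Xe, h.Ye,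
    h.ee]; ring

theorem IsEdge.form_barycenter_other {X Y e f : Mink n} (h : IsEdge X Y e f) (T : ℝ) :
    form f (barycenter X Y e T) = Real.sqrt 3 / 3 * form e f := by
  simp only [barycenter, form_smul_right, form_add_right, form_comm f X, form_comm f Y,
    form_comm f e, h.Xf, h.Yf]; ring

theorem IsEdge.form_barycenter_barycenter {X Y e f : Mink n} (h : IsEdge X Y e f) (T : ℝ) :
    form (barycenter X Y e 0) (barycenter X Y f T) =
      -(2 / 3 * (Real.exp T + Real.exp (-T)) - form e f / 3) := by
  have h3 : Real.sqrt 3 * Real.sqrt 3 = 3 := Real.mul_self_sqrt (by norm_num)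
  rw [barycenter, form_smul_left, form_add_left, form_add_left, form_smul_left, form_smul_left,
    form_smul_left, h.symm.form_barycenter_X, h.symm.form_barycenter_Y,
    h.symm.form_barycenter_other, neg_zero, Real.exp_zero, form_comm f e]
  linear_combination (1 / 9 * form e f) * h3

/-- The solution `l` of `cosh l = 4 / 3 * cosh T - r / 3`, in terms of `K = exp T` and
`κ = exp (-T)`. -/
theorem abs_sub_log_le {l K κ r : ℝ} (hl : 0 ≤ l) (hK : 0 < K) (hKκ : K * κ = 1)
    (hκ : κ ≤ 1 / 100) (hr : |r| ≤ 1) (hc : Real.cosh l = 2 / 3 * (K + κ) - r / 3) :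
    |l - (Real.log K + Real.log (4 / 3))| ≤ 2 * κ := by
  have hκ0 : 0 < κ := by by_contra h; push Not at h; nlinarith
  have hr' := abs_le.1 hr
  have hsinh : 0 ≤ Real.sinh l := Real.sinh_nonneg_iff.2 hl
  have h1 := Real.cosh_add_sinh l
  have h2 := Real.cosh_sub_sinh l
  have h3 : Real.exp (-l) ≤ 1 := by simpa using hl
  have h4 := Real.exp_pos (-l)
  have hlog : Real.log K + Real.log (4 / 3) = Real.log (K * (4 / 3)) :=
    (Real.log_mul hK.ne' (by norm_num)).symm
  have hK0 : 0 < K * (4 / 3) := by positivity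
  have hexp : Real.exp (Real.log K + Real.log (4 / 3)) = K * (4 / 3) := by
    rw [hlog, Real.exp_log hK0]
  rw [abs_le]
  constructor
  · rw [neg_le_sub_iff_le_add, ← Real.exp_le_exp, hexp, Real.exp_add]
    have h5 := Real.add_one_le_exp (2 * κ)
    have h6 : K * (4 / 3) - 5 / 3 ≤ Real.exp l := by linarith
    have h7 : 0 ≤ K * (4 / 3) - 5 / 3 := by nlinarith
    calc K * (4 / 3) ≤ (K * (4 / 3) - 5 / 3) * (2 * κ + 1) := by nlinarith
      _ ≤ _ := mul_le_mul h6 h5 (by positivity) (Real.exp_pos _).le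
  · rw [sub_le_iff_le_add, ← Real.exp_le_exp, Real.exp_add, hexp]
    have h5 := Real.add_one_le_exp (2 * κ)
    calc Real.exp l ≤ (2 * κ + 1) * (K * (4 / 3)) := by nlinarith
      _ ≤ _ := mul_le_mul_of_nonneg_right h5 hK0.le

theorem mem_hyp_form_lt {p q : Mink n} (hp : p ∈ hyp n) (hq : q ∈ hyp n) : form p q < 0 := by
  refine lt_of_le_of_ne (form_nonpos (by rw [hp.1]; norm_num) (by rw [hq.1]; norm_num) hp.2 hq.2)
    fun h => ?_
  have := form_self_nonneg (by rw [hp.1]; norm_num) hp.2.ne' h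
  rw [hq.1] at this
  linarith

/-- The Lorentz transformation that restricts to parallel transport from `p` to `q` on the tangent
space at `p`: the product of the point reflection in `p` and the reflection exchanging `-p` and
`q`. -/
noncomputable def transvection (p q : Mink n) : Matrix (Fin (n + 1)) (Fin (n + 1)) ℝ :=
  reflection (p + q) * reflection p

theorem form_add_self_hyp {p q : Mink n} (hp : p ∈ hyp n) (hq : q ∈ hyp n) :
    form (p + q) (p + q) = -2 * (1 - form p q) := by
  simp only [form_add_left, form_add_right, hp.1, hq.1, form_comm q p]; ring

theorem form_add_self_hyp_ne_zero {p q : Mink n} (hp : p ∈ hyp n) (hq : q ∈ hyp n) :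
    form (p + q) (p + q) ≠ 0 := by
  have := mem_hyp_form_lt hp hq
  rw [form_add_self_hyp hp hq]
  linarith

theorem isLorentz_transvection {p q : Mink n} (hp : p ∈ hyp n) (hq : q ∈ hyp n) :
    IsLorentz (transvection p q) :=
  (isLorentz_reflection (form_add_self_hyp_ne_zero hp hq)).mul
    (isLorentz_reflection (by rw [hp.1]; norm_num))

theorem det_transvection {p q : Mink n} (hp : p ∈ hyp n) (hq : q ∈ hyp n) :
    (transvection p q).det = 1 := by
  rw [transvection, Matrix.det_mul, det_reflection (form_add_self_hyp_ne_zero hp hq),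
    det_reflection (by rw [hp.1]; norm_num)]
  norm_num

theorem transvection_base {p q : Mink n} (hp : p ∈ hyp n) (hq : q ∈ hyp n) :
    transvection p q *ᵥ p = q := by
  rw [transvection, ← Matrix.mulVec_mulVec, reflection_self (by rw [hp.1]; norm_num),
    Matrix.mulVec_neg, reflection_mulVec]
  have : 2 * form (p + q) p / form (p + q) (p + q) = 1 := by
    rw [div_eq_one_iff_eq (form_add_self_hyp_ne_zero hp hq)]
    simp only [form_add_left, form_add_right, hp.1, hq.1, form_comm q p]; ring
  rw [this, one_smul]; abel

theorem transvection_mulVec {p q ζ : Mink n} (hp : p ∈ hyp n) (hq : q ∈ hyp n)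
    (hζ : form p ζ = 0) :
    transvection p q *ᵥ ζ = ζ + (form ζ q / (1 - form p q)) • (p + q) := by
  rw [transvection, ← Matrix.mulVec_mulVec, reflection_of_orthogonal hζ, reflection_mulVec,
    form_add_self_hyp hp hq, form_add_left, hζ, form_comm q ζ, sub_eq_add_neg, ← neg_smul]
  have : 1 - form p q ≠ 0 := by linarith [mem_hyp_form_lt hp hq]
  congr 2
  field_simp
  ring

/-- The transvection restricts to parallel transport along the segment from `p` to `q`, whose initial
velocity is `w`. -/
theorem transport_eq_transvection {p q w ζ : Mink n} {l : ℝ} (hp : p ∈ hyp n) (hq : q ∈ hyp n)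
    (hl : 0 < l) (hw : w = (Real.sinh l)⁻¹ • (q - Real.cosh l • p))
    (hpq : form p q = -Real.cosh l) (hζ : form p ζ = 0) :
    transport p w l ζ = transvection p q *ᵥ ζ := by
  have hS : 0 < Real.sinh l := Real.sinh_pos_iff.2 hl
  have hC : 0 < Real.cosh l := Real.cosh_pos l
  have hCS := Real.cosh_sq l
  have hζw : form ζ w = form ζ q / Real.sinh l := by
    rw [hw, form_smul_right, form_sub_right, form_smul_right, form_comm ζ p, hζ]
    field_simp
    ring
  have hcoef : ∀ a : ℝ, a / (1 - -Real.cosh l) = a / Real.sinh l *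
      ((Real.cosh l - 1) / Real.sinh l) := fun a => by
    have : 1 + Real.cosh l ≠ 0 := by positivity
    rw [sub_neg_eq_add]
    field_simp
    linear_combination (-a) * hCS
  rw [transvection_mulVec hp hq hζ, hpq, transport, hζw, geoVel, hcoef, hw]
  ext j
  simp only [Pi.add_apply, Pi.sub_apply, Pi.smul_apply, smul_eq_mul]
  field_simp
  linear_combination (-form ζ q * p j) * hCS


theorem IsEdge.timelike {X Y e f : Mink n} (h : IsEdge X Y e f) :
    form (X + Y) (X + Y) ≤ 0 ∧ (X + Y) 0 ≠ 0 := by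
  have h1 : form (X + Y) (X + Y) = -3 := by
    simp only [form_add_left, form_add_right, h.XX, h.YY, form_comm Y X, h.XY]; norm_num
  refine ⟨by rw [h1]; norm_num, fun h0 => ?_⟩
  have h2 : 0 ≤ form (X + Y) (X + Y) := by
    rw [form, h0, mul_zero, neg_zero, zero_add]
    exact Finset.sum_nonneg fun i _ => mul_self_nonneg _
  linarith

theorem IsEdge.form_sq_le {X Y e f x y : Mink n} (h : IsEdge X Y e f) (hXx : form X x = 0)
    (hYx : form Y x = 0) (hXy : form X y = 0) (hYy : form Y y = 0) :
    form x y ^ 2 ≤ form x x * form y y :=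
  HypPants.form_sq_le h.timelike.1 h.timelike.2 (by simp [hXx, hYx]) (by simp [hXy, hYy])

theorem IsEdge.abs_form_le {X Y e f : Mink n} (h : IsEdge X Y e f) : |form e f| ≤ 1 := by
  have := h.form_sq_le h.Xe h.Ye h.Xf h.Yf
  rw [h.ee, h.ff] at this
  exact abs_le_one_iff_mul_self_le_one.2 (by linarith)

/-- The hyperbolic distance between the two barycenters is close to the shear plus `log (4 / 3)`,
and the segment between them leaves and arrives almost in the direction of the ends of the edge. -/
theorem IsEdge.exists_segment {X Y e f p q : Mink n} {T δ : ℝ} (h : IsEdge X Y e f)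
    (hp : p = barycenter X Y e 0) (hq : q = barycenter X Y f T) (hph : p ∈ hyp n)
    (hqh : q ∈ hyp n) (hT : Real.exp (-T) ≤ 1 / 100) (hδ : 0 ≤ δ)
    (hTδ : 10 * Real.exp (-T) ^ 2 ≤ δ ^ 2) :
    ∃ w l, IsUnitTangent p w ∧ 0 < l ∧ geo p w l = q ∧
      |l - (T + Real.log (4 / 3))| ≤ 2 * Real.exp (-T) ∧ angle (X - p) w ≤ δ ∧
      angle (Real.exp (-T) • Y - q) (-geoVel p w l) ≤ δ ∧
      ∀ ζ, form p ζ = 0 → transport p w l ζ = transvection p q *ᵥ ζ := by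
  have hr' := abs_le.1 h.abs_form_le
  have hXp : form X p = -1 := by rw [hp, h.form_barycenter_X, neg_zero, Real.exp_zero]
  have hYp : form Y p = -1 := by rw [hp, h.form_barycenter_Y, Real.exp_zero]
  have hXq : form X q = -Real.exp (-T) := by rw [hq, h.symm.form_barycenter_X]
  have hYq : form Y q = -Real.exp T := by rw [hq, h.symm.form_barycenter_Y]
  have hpq : form p q = -(2 / 3 * (Real.exp T + Real.exp (-T)) - form e f / 3) := by
    rw [hp, hq, h.form_barycenter_barycenter]
  have hκ0 : 0 < Real.exp (-T) := Real.exp_pos _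
  have hK0 : 0 < Real.exp T := Real.exp_pos _
  have hKκ : Real.exp T * Real.exp (-T) = 1 := by
    rw [← Real.exp_add, add_neg_cancel, Real.exp_zero]
  have hlog := Real.log_exp T
  generalize Real.exp (-T) = κ at *
  generalize Real.exp T = K at *
  generalize form e f = r at *
  have hK100 : 100 ≤ K := by nlinarith
  obtain ⟨c, hc⟩ : ∃ c, c = 2 / 3 * (K + κ) - r / 3 := ⟨_, rfl⟩
  have hc1 : K / 2 + 1 ≤ c := by linarith
  obtain ⟨l, hl, hcl⟩ : ∃ l, 0 < l ∧ Real.cosh l = c :=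
    ⟨Real.arcosh c, Real.arcosh_pos (by linarith), Real.cosh_arcosh (by linarith)⟩
  have hpq' : form p q = -c := by rw [hc, hpq]
  have hlen := abs_sub_log_le hl.le hK0 hKκ hT (abs_le.2 hr') (hcl.trans hc)
  have htr := fun ζ => transport_eq_transvection (ζ := ζ) hph hqh hl rfl (by rw [hcl, hpq'])
  have hS0 : 0 < Real.sinh l := Real.sinh_pos_iff.2 hl
  have hCS := Real.cosh_sq l
  rw [hlog] at hlen
  refine ⟨(Real.sinh l)⁻¹ • (q - Real.cosh l • p), l, ?_, hl, ?_, hlen, ?_, ?_, htr⟩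
  all_goals clear htr hlen
  all_goals simp only [geo, geoVel, hcl] at *
  all_goals generalize Real.sinh l = S at *
  · constructor
    · rw [form_smul_right, form_sub_right, form_smul_right, hpq', hph.1]; ring
    · simp only [form_smul_right, form_smul_left, form_sub_right, form_sub_left, hpq', hph.1,
        hqh.1, form_comm q p]
      field_simp
      linear_combination hCS
  · rw [smul_smul, mul_inv_cancel₀ hS0.ne', one_smul]; abel
  all_goals
    have hcos : ∀ z, z = (c - κ) / S → Real.arccos z ≤ δ := fun z hz => by
      refine arccos_le_of_le hδ ?_
      have hSc : S < c := by nlinarith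
      have hSK : K / 2 ≤ S := by nlinarith
      have h1 : 1 - 2 * κ ^ 2 ≤ z := by
        rw [hz, le_div_iff₀ hS0]
        have h2 : 1 / 2 ≤ κ * S := by
          calc 1 / 2 = κ * (K / 2) := by linarith
            _ ≤ _ := mul_le_mul_of_nonneg_left hSK hκ0.le
        have h3 : κ * (1 / 2) ≤ κ * (κ * S) := mul_le_mul_of_nonneg_left h2 hκ0.le
        linarith
      have h2 : 1 / 5 ≤ 2 / Real.pi ^ 2 := by
        rw [div_le_div_iff₀ (by norm_num) (by positivity)]
        nlinarith [Real.pi_lt_d2, Real.pi_pos]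
      have h3 := mul_le_mul_of_nonneg_right h2 (sq_nonneg δ)
      linarith
    refine hcos _ ?_
  · rw [form_smul_right, form_sub_left, form_sub_right, form_sub_right, form_smul_right,
      form_smul_right, hXq, hXp, hpq', hph.1]
    field_simp
    ring
  · have hvel : S • p + c • S⁻¹ • (q - c • p) = S⁻¹ • (c • q - p) := by
      ext j
      simp only [Pi.add_apply, Pi.sub_apply, Pi.smul_apply, smul_eq_mul]
      field_simp
      linear_combination (-p j) * hCS
    rw [hvel]
    simp only [form_neg_right, form_smul_right, form_smul_left, form_sub_left, form_sub_right,
      hYq, hYp, hqh.1, form_comm q p, hpq']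
    field_simp
    linear_combination c * hKκ

/-- The denominator in the formula for the transvection is large. -/
theorem IsEdge.inv_le {X Y e f p q : Mink n} {T : ℝ} (h : IsEdge X Y e f)
    (hp : p = barycenter X Y e 0) (hq : q = barycenter X Y f T)
    (hT : Real.exp (-T) ≤ 1 / 100) :
    0 < 1 - form p q ∧ 1 / (1 - form p q) ≤ 2 * Real.exp (-T) := by
  have hr' := abs_le.1 h.abs_form_le
  have hpq : form p q = -(2 / 3 * (Real.exp T + Real.exp (-T)) - form e f / 3) := by
    rw [hp, hq, h.form_barycenter_barycenter]
  have hκ0 : 0 < Real.exp (-T) := Real.exp_pos _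
  have hK0 : 0 < Real.exp T := Real.exp_pos _
  have hKκ : Real.exp T * Real.exp (-T) = 1 := by
    rw [← Real.exp_add, add_neg_cancel, Real.exp_zero]
  rw [hpq]
  have h1 : Real.exp T / 2 ≤
      1 - -(2 / 3 * (Real.exp T + Real.exp (-T)) - form e f / 3) := by linarith
  have h2 : 0 < 1 - -(2 / 3 * (Real.exp T + Real.exp (-T)) - form e f / 3) := by linarith
  refine ⟨h2, ?_⟩
  rw [div_le_iff₀ h2]
  calc 1 = 2 * Real.exp (-T) * (Real.exp T / 2) := by linarith
    _ ≤ _ := mul_le_mul_of_nonneg_left h1 (by positivity)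

/-- Parallel transport carries the leg `X - p` to almost the opposite of the leg
`exp (-T) Y - q`. -/
theorem IsEdge.transvection_leg {X Y e f p q : Mink n} {T : ℝ} (h : IsEdge X Y e f)
    (hp : p = barycenter X Y e 0) (hq : q = barycenter X Y f T) (hph : p ∈ hyp n)
    (hqh : q ∈ hyp n) (hT : Real.exp (-T) ≤ 1 / 100) :
    form (Real.exp (-T) • Y - q + transvection p q *ᵥ (X - p))
      (Real.exp (-T) • Y - q + transvection p q *ᵥ (X - p)) ≤ 8 * Real.exp (-T) := by
  obtain ⟨hc0, hc⟩ := h.inv_le hp hq hT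
  have hXp : form X p = -1 := by rw [hp, h.form_barycenter_X, neg_zero, Real.exp_zero]
  have hYp : form Y p = -1 := by rw [hp, h.form_barycenter_Y, Real.exp_zero]
  have hXq : form X q = -Real.exp (-T) := by rw [hq, h.symm.form_barycenter_X]
  have hYq : form Y q = -Real.exp T := by rw [hq, h.symm.form_barycenter_Y]
  have hκ0 : 0 < Real.exp (-T) := Real.exp_pos _
  have hKκ : Real.exp T * Real.exp (-T) = 1 := by
    rw [← Real.exp_add, add_neg_cancel, Real.exp_zero]
  have hpq0 := mem_hyp_form_lt hph hqh
  have htr := transvection_mulVec (ζ := X - p) hph hqh (by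
    rw [form_sub_right, form_comm p X, hXp, hph.1]; ring)
  have hL := isLorentz_transvection hph hqh
  generalize Real.exp (-T) = κ at *
  generalize Real.exp T = K at *
  obtain ⟨c, hcpq⟩ : ∃ c, form p q = -c := ⟨_, (neg_neg _).symm⟩
  have hu : form (κ • Y - q) (transvection p q *ᵥ (X - p)) =
      κ / 2 - c + (c - κ) ^ 2 * (1 / (1 + c)) := by
    rw [htr]
    simp only [form_add_right, form_smul_right, form_sub_left, form_sub_right, form_smul_left,
      form_comm Y X, h.XY, hYp, hXq, hYq, hcpq, form_comm q X, form_comm q p, hqh.1]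
    linear_combination (-(c - κ) * (1 / (1 + c))) * hKκ
  have h1 : form (κ • Y - q + transvection p q *ᵥ (X - p))
      (κ • Y - q + transvection p q *ᵥ (X - p)) =
      2 * (1 + κ / 2 - 3 / 2 * κ * c + κ ^ 2) * (1 / (1 + c)) := by
    rw [form_add_left, form_add_right, form_add_right, form_comm (transvection p q *ᵥ (X - p)), hu,
      hL]
    simp only [form_sub_left, form_sub_right, form_smul_left, form_smul_right, h.YY, h.XX,
      form_comm p X, hXp, hYq, form_comm q Y, hph.1, hqh.1]
    have : 1 + c ≠ 0 := by rw [hcpq] at hc0; linarith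
    field_simp
    linear_combination (4 * (1 + c)) * hKκ
  rw [h1]
  rw [hcpq, sub_neg_eq_add] at hc0 hc
  have h3 : 1 + κ / 2 - 3 / 2 * κ * c + κ ^ 2 ≤ 2 := by
    have : 0 ≤ κ * c := mul_nonneg hκ0.le (by linarith)
    nlinarith
  have h4 : 0 ≤ 1 / (1 + c) := by positivity
  calc _ ≤ 2 * 2 * (1 / (1 + c)) := by gcongr
    _ ≤ _ := by linarith

/-- The second vectors of the frames, perpendicular to the legs in the planes of the triangles, are
compared through the normals `e` and `f` of the edge. -/
theorem IsEdge.transvection_perp {X Y e f p q : Mink n} {T σ : ℝ} (hσ : σ ^ 2 = 1)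
    (h : IsEdge X Y e f) (hp : p = barycenter X Y e 0) (hq : q = barycenter X Y f T)
    (hph : p ∈ hyp n) (hqh : q ∈ hyp n) (hT : Real.exp (-T) ≤ 1 / 100) :
    form (f + (Real.exp (-T) * (Real.sqrt 3)⁻¹) • Y +
        σ • transvection p q *ᵥ (e + (Real.sqrt 3)⁻¹ • X))
      (f + (Real.exp (-T) * (Real.sqrt 3)⁻¹) • Y +
        σ • transvection p q *ᵥ (e + (Real.sqrt 3)⁻¹ • X)) ≤
      form (f + σ • e) (f + σ • e) + 7 * Real.exp (-T) := by
  obtain ⟨hc0, hc⟩ := h.inv_le hp hq hT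
  have hr' := abs_le.1 h.abs_form_le
  have hYp : form Y p = -1 := by rw [hp, h.form_barycenter_Y, Real.exp_zero]
  have hXp : form X p = -1 := by rw [hp, h.form_barycenter_X, neg_zero, Real.exp_zero]
  have hXq : form X q = -Real.exp (-T) := by rw [hq, h.symm.form_barycenter_X]
  have hYq : form Y q = -Real.exp T := by rw [hq, h.symm.form_barycenter_Y]
  have hep : form e p = Real.sqrt 3 / 3 := by rw [hp, h.form_barycenter_self]
  have hfp : form f p = Real.sqrt 3 / 3 * form e f := by rw [hp, h.form_barycenter_other]
  have hfq : form f q = Real.sqrt 3 / 3 := by rw [hq, h.symm.form_barycenter_self]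
  have heq : form e q = Real.sqrt 3 / 3 * form e f := by
    rw [hq, h.symm.form_barycenter_other, form_comm f e]
  have hκ0 : 0 < Real.exp (-T) := Real.exp_pos _
  have hKκ : Real.exp T * Real.exp (-T) = 1 := by
    rw [← Real.exp_add, add_neg_cancel, Real.exp_zero]
  have h33 : Real.sqrt 3 * Real.sqrt 3 = 3 := Real.mul_self_sqrt (by norm_num)
  have hinv : (Real.sqrt 3)⁻¹ = Real.sqrt 3 / 3 := by
    have h30 : 0 < Real.sqrt 3 := Real.sqrt_pos.2 (by norm_num)
    field_simp
    linarith
  rw [hinv]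
  have htr := transvection_mulVec (ζ := e + (Real.sqrt 3 / 3) • X) hph hqh (by
    rw [form_add_right, form_smul_right, form_comm p e, hep, form_comm p X, hXp]; ring)
  have hL := isLorentz_transvection hph hqh
  generalize Real.exp (-T) = κ at *
  generalize Real.exp T = K at *
  have hu : form (f + (κ * (Real.sqrt 3 / 3)) • Y)
      (transvection p q *ᵥ (e + (Real.sqrt 3 / 3) • X)) =
      form e f - κ / 2 + (form e f - κ) ^ 2 / 3 * (1 / (1 - form p q)) := by
    rw [htr]
    simp only [form_add_right, form_smul_right, form_add_left, form_smul_left,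
      form_comm Y X, h.XY, hYp, hXq, hYq, form_comm f e, form_comm f X, h.Xf, h.Ye, hfp, hfq, heq]
    generalize form e f = r
    linear_combination (-κ / 6 + (r - κ) ^ 2 / 9 * (1 / (1 - form p q))) * h33 -
      (Real.sqrt 3) ^ 2 / 9 * (r - κ) * (1 / (1 - form p q)) * hKκ
  have hMM : form (transvection p q *ᵥ (e + (Real.sqrt 3 / 3) • X))
      (transvection p q *ᵥ (e + (Real.sqrt 3 / 3) • X)) = 1 := by
    rw [hL]
    simp [h.ee, h.Xe, h.XX, form_comm e X]
  have h7 : form (f + σ • e) (f + σ • e) = 2 + 2 * (σ * form e f) := by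
    simp only [form_add_left, form_add_right, form_smul_left, form_smul_right, h.ee, h.ff,
      form_comm f e]
    linear_combination hσ
  have h8 : form (f + (κ * (Real.sqrt 3 / 3)) • Y + σ • transvection p q *ᵥ
        (e + (Real.sqrt 3 / 3) • X)) (f + (κ * (Real.sqrt 3 / 3)) • Y + σ • transvection p q *ᵥ
        (e + (Real.sqrt 3 / 3) • X)) =
      2 + 2 * (σ * form e f) +
        2 * (σ * (-(κ / 2) + (form e f - κ) ^ 2 / 3 * (1 / (1 - form p q)))) := by
    rw [form_add_left _ (σ • _), form_add_right _ (σ • _), form_add_right _ (σ • _),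
      form_comm (σ • _)]
    simp only [form_smul_right, form_smul_left σ, hu, hMM]
    simp only [form_add_left, form_add_right, form_smul_right, form_smul_left, h.ff,
      h.Yf, h.YY, form_comm f Y]
    linear_combination hσ
  rw [h7, h8]
  generalize form e f = r at *
  have hz0 : 0 ≤ 1 / (1 - form p q) := by positivity
  generalize 1 / (1 - form p q) = z at *
  have h9 : (r - κ) ^ 2 ≤ 2 := by nlinarith
  have h10 : (r - κ) ^ 2 / 3 * z ≤ 2 / 3 * (2 * κ) :=
    mul_le_mul (by linarith) hc hz0 (by norm_num)
  have h11 : 0 ≤ (r - κ) ^ 2 / 3 * z := by positivity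
  rcases eq_or_eq_neg_of_sq_eq_sq σ 1 (by rw [hσ, one_pow]) with h0 | h0 <;> rw [h0] <;> linarith

/-- Parallel transport hardly moves the normal vectors of the first triangle, in comparison with the
normal vectors of the second one. -/
theorem IsEdge.transvection_normal {X Y e f p q ξ η : Mink n} {T m : ℝ} (h : IsEdge X Y e f)
    (hp : p = barycenter X Y e 0) (hq : q = barycenter X Y f T) (hph : p ∈ hyp n)
    (hqh : q ∈ hyp n) (hT : Real.exp (-T) ≤ 1 / 100) (hXξ : form X ξ = 0) (hYξ : form Y ξ = 0)
    (heξ : form e ξ = 0) (hXη : form X η = 0) (hYη : form Y η = 0) (hfη : form f η = 0)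
    (hξ : form ξ ξ = m) (hη : form η η = m) :
    form (η - transvection p q *ᵥ ξ) (η - transvection p q *ᵥ ξ) ≤
      form (η - ξ) (η - ξ) + 2 * Real.exp (-T) * m := by
  obtain ⟨hc0, hc⟩ := h.inv_le hp hq hT
  have hκ0 : 0 < Real.exp (-T) := Real.exp_pos _
  have h33 : Real.sqrt 3 * Real.sqrt 3 = 3 := Real.mul_self_sqrt (by norm_num)
  have hpξ : form p ξ = 0 := by
    rw [hp, barycenter]; simp [hXξ, hYξ, heξ]
  have hqη : form q η = 0 := by
    rw [hq, barycenter]; simp [hXη, hYη, hfη]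
  have hqξ : form ξ q = Real.sqrt 3 / 3 * form f ξ := by
    rw [hq, form_comm, barycenter]; simp [hXξ, hYξ]; ring
  have hpη : form p η = Real.sqrt 3 / 3 * form e η := by
    rw [hp, barycenter]; simp [hXη, hYη]; ring
  have hu : form η (transvection p q *ᵥ ξ) =
      form η ξ + form f ξ * form e η / 3 * (1 / (1 - form p q)) := by
    rw [transvection_mulVec hph hqh hpξ, form_add_right, form_smul_right, form_add_right,
      form_comm η q, hqη, form_comm η p, hpη, hqξ]
    linear_combination form f ξ * form e η / 9 * (1 / (1 - form p q)) * h33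
  have h1 := h.form_sq_le h.Xf h.Yf hXξ hYξ
  have h2 := h.form_sq_le h.Xe h.Ye hXη hYη
  rw [h.ff, hξ] at h1
  rw [h.ee, hη] at h2
  rw [form_sub_left, form_sub_right, form_sub_right, form_comm (transvection p q *ᵥ ξ), hu,
    isLorentz_transvection hph hqh, form_sub_left, form_sub_right, form_sub_right, form_comm ξ η]
  have hz0 : 0 ≤ 1 / (1 - form p q) := by positivity
  generalize 1 / (1 - form p q) = z at *
  have hm : 0 ≤ m := by nlinarith
  have h3 : -(form f ξ * form e η) ≤ m := by nlinarith [sq_nonneg (form f ξ + form e η)]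
  have h4 : -(form f ξ * form e η) * z ≤ m * (2 * Real.exp (-T)) :=
    (mul_le_mul_of_nonneg_right h3 hz0).trans (mul_le_mul_of_nonneg_left hc hm)
  have h5 : 0 ≤ m * Real.exp (-T) := by positivity
  linarith

theorem IsPosFrame.negFirstTwo {d : ℕ} {q : Mink (d + 2)} {A : Fin (d + 2) → Mink (d + 2)}
    (hA : IsPosFrame q A) : IsPosFrame q (negFirstTwo A) where
  base := hA.base
  tangent i := by
    simp only [HypPants.negFirstTwo]
    split_ifs <;> simp [hA.tangent]
  orthonormal i j := by
    simp only [HypPants.negFirstTwo]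
    split_ifs with h1 h2 h3 h4 h5 h6 <;> simp [hA.orthonormal, *] <;> grind
  positive := by
    have : Matrix.of (Matrix.vecCons q (HypPants.negFirstTwo A)) =
        Matrix.diagonal (Fin.cons 1 fun j : Fin (d + 2) => if (j : ℕ) < 2 then (-1 : ℝ) else 1) *
          Matrix.of (Matrix.vecCons q A) := by
      ext i j
      refine Fin.cases ?_ (fun k => ?_) i
      · simp [Matrix.diagonal_mul]
      · simp only [Matrix.of_apply, Matrix.cons_val_succ, HypPants.negFirstTwo,
          Matrix.diagonal_mul, Fin.cons_succ]
        split_ifs <;> simp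
    rw [this, Matrix.det_mul, Matrix.det_diagonal]
    simpa [Fin.prod_univ_succ] using hA.positive

end Edge

section Connection

variable {d : ℕ}

/-- The signs `(1, σ, σ, 1, …, 1)`. -/
def signs (σ : ℝ) (m : ℕ) (j : Fin m) : ℝ := if (j : ℕ) = 1 ∨ (j : ℕ) = 2 then σ else 1

/-- Two framed tripods on both sides of a common ideal edge of shear `T` close to `R` are connected
by the geodesic segment between their base points, with monodromy close to `diag (1, σ, σ, 1, …)`,
as soon as the normals `e`, `f` and the frames `E`, `F` agree approximately up to these signs. -/
theorem isConnection_of_isEdge {P Q : FramedTripod d}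
    {g : Matrix.SpecialLinearGroup (Fin (d + 2 + 1)) ℝ} {i : Fin 3} (hg : g ∈ SOplus (d + 2))
    {X Y e f : Mink (d + 2)} {T R ε σ : ℝ} (hσ : σ ^ 2 = 1) (h : IsEdge X Y e f)
    (hp : P.base = barycenter X Y e 0) (hq : g.1 *ᵥ Q.base = barycenter X Y f T)
    (hv : P.v i = X - P.base) (hv' : perp P.v i = e + (Real.sqrt 3)⁻¹ • X)
    (hu : g.1 *ᵥ Q.v (-i) = Real.exp (-T) • Y - g.1 *ᵥ Q.base)
    (hu' : g.1 *ᵥ perp Q.v (-i) = f + (Real.exp (-T) * (Real.sqrt 3)⁻¹) • Y)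
    (hε : 0 < ε) (hTR : |T - R| ≤ 3 * ε) (hT1 : Real.exp (-T) ≤ 1 / 100)
    (hT2 : Real.exp (-T) ≤ ε / 20) (hT3 : Real.exp (-T) ≤ ε ^ 2 / 100)
    (hT4 : 10 * Real.exp (-T) ^ 2 ≤ Real.exp (-(R / 4)) ^ 2)
    (hfe : form (f + σ • e) (f + σ • e) ≤ 11 * ε ^ 2)
    (hEF : ∀ a : Fin d → ℝ,
      form (∑ k, a k • (g.1 *ᵥ Q.E k - (if (k : ℕ) = 0 then σ else 1) • P.E k))
        (∑ k, a k • (g.1 *ᵥ Q.E k - (if (k : ℕ) = 0 then σ else 1) • P.E k)) ≤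
        11 * ε ^ 2 * ∑ k, a k ^ 2) :
    IsConnection R (10 * ε) (Matrix.diagonal (signs σ (d + 2))) P Q g i := by
  have hph : P.base ∈ hyp (d + 2) := P.base_mem
  have hqh : g.1 *ᵥ Q.base ∈ hyp (d + 2) := (hg.2 _).2 Q.base_mem
  have hML := isLorentz_transvection hph hqh
  have hMp := transvection_base hph hqh
  have hMdet := det_transvection hph hqh
  obtain ⟨w, l, hw, hl, hgeo, hlen, hang, hang', htr⟩ :=
    h.exists_segment hp hq hph hqh hT1 (Real.exp_pos (-(R / 4))).le hT4
  have hfirst := h.transvection_leg hp hq hph hqh hT1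
  have hsecond := h.transvection_perp hσ hp hq hph hqh hT1
  rw [← hu, ← hv] at hfirst
  rw [← hu', ← hv'] at hsecond
  have hA : IsPosFrame (g.1 *ᵥ Q.base)
      (negFirstTwo fun a => transport P.base w l (tripodFrame P.v P.E i a)) := by
    have h1 := (P.frame i).map hML (by rw [hMdet]; exact one_pos) (by rw [hMp]; exact hqh)
    rw [hMp] at h1
    have h2 : (fun a => transport P.base w l (tripodFrame P.v P.E i a)) =
        fun a => transvection P.base (g.1 *ᵥ Q.base) *ᵥ tripodFrame P.v P.E i a :=
      funext fun a => htr _ ((P.frame i).tangent a)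
    rw [h2]
    exact h1.negFirstTwo
  have hB : IsPosFrame (g.1 *ᵥ Q.base) (fun k => g.1 *ᵥ tripodFrame Q.v Q.E (-i) k) :=
    (Q.frame (-i)).map hg.1 (by rw [g.2]; exact one_pos) hqh
  obtain ⟨Xr, hXr, hXAB, hexp⟩ := hA.exists_rotation hB
  have hTR' := abs_le.1 hTR
  have hlen' := abs_le.1 hlen
  refine ⟨w, l, hw, hl, hgeo, by linarith, by linarith, by rw [hv]; exact hang,
    by rw [hu]; exact hang', Xr, hXr, hexp, ?_⟩
  refine rotClose_diagonal hA hB hXr hXAB _ (fun j => ?_) hε fun a ha => ?_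
  · unfold signs; split_ifs <;> simp [hσ]
  have hpv : form P.base (P.v i) = 0 := (P.unit i).1
  have hpv' : form P.base (perp P.v i) = 0 := (P.frame i).tangent 1
  have hpE : ∀ k, form P.base (P.E k) = 0 := fun k => (P.frame i).tangent k.succ.succ
  have hqu : form (g.1 *ᵥ Q.base) (g.1 *ᵥ Q.v (-i)) = 0 := hB.tangent 0
  have hqu' : form (g.1 *ᵥ Q.base) (g.1 *ᵥ perp Q.v (-i)) = 0 := hB.tangent 1
  have hqF : ∀ k, form (g.1 *ᵥ Q.base) (g.1 *ᵥ Q.E k) = 0 := fun k => hB.tangent k.succ.succ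
  set b : Fin d → ℝ := fun k => a k.succ.succ with hb
  set s : Fin d → ℝ := fun k => if (k : ℕ) = 0 then σ else 1 with hs
  set ξ := ∑ k, b k • s k • P.E k with hξ
  set η := ∑ k, b k • (g.1 *ᵥ Q.E k) with hη
  set M := transvection P.base (g.1 *ᵥ Q.base) with hM
  have hsplit : ∑ k, a k • (g.1 *ᵥ tripodFrame Q.v Q.E (-i) k - signs σ (d + 2) k •
      negFirstTwo (fun a => transport P.base w l (tripodFrame P.v P.E i a)) k) =
      a 0 • (g.1 *ᵥ Q.v (-i) + M *ᵥ P.v i) +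
        a 1 • (g.1 *ᵥ perp Q.v (-i) + σ • M *ᵥ perp P.v i) + (η - M *ᵥ ξ) := by
    rw [Fin.sum_univ_succ, Fin.sum_univ_succ, ← add_assoc]
    congr 1
    · congr 1
      · simp [signs, negFirstTwo, tripodFrame, htr _ hpv]
      · simp [signs, negFirstTwo, tripodFrame, htr _ hpv']
    · rw [hη, hξ, Matrix.mulVec_sum, ← Finset.sum_sub_distrib]
      refine Finset.sum_congr rfl fun k _ => ?_
      rw [Matrix.mulVec_smul, Matrix.mulVec_smul, ← smul_sub]
      simp [signs, negFirstTwo, tripodFrame, htr _ (hpE k), hs, hb]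
  have hpξ : form P.base ξ = 0 := by
    rw [hξ, form_sum_right]; simp [hpE]
  have hqη : form (g.1 *ᵥ Q.base) η = 0 := by
    rw [hη, form_sum_right]; simp [hqF]
  have hqM : ∀ ζ, form P.base ζ = 0 → form (g.1 *ᵥ Q.base) (M *ᵥ ζ) = 0 := fun ζ hζ => by
    rw [← hMp, hML]; exact hζ
  -- The frames of the tripods are orthogonal to the edge and to the normals of the edge.
  have hPE : ∀ k, form X (P.E k) = 0 ∧ form Y (P.E k) = 0 ∧ form e (P.E k) = 0 := fun k => by
    have h1 : form (P.v i) (P.E k) = 0 := by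
      simpa [tripodFrame, (Fin.succ_ne_zero _).symm] using (P.frame i).orthonormal 0 k.succ.succ
    have h2 : form (perp P.v i) (P.E k) = 0 := by
      simpa [tripodFrame, Fin.ext_iff] using (P.frame i).orthonormal 1 k.succ.succ
    have hX : form X (P.E k) = 0 := by rw [hv, form_sub_left, hpE] at h1; linarith
    have he : form e (P.E k) = 0 := by
      rw [hv', form_add_left, form_smul_left, hX] at h2; linarith
    have h3 := hpE k
    rw [hp, barycenter] at h3
    simp only [form_smul_left, form_add_left, hX, he, neg_zero, Real.exp_zero] at h3
    exact ⟨hX, by linarith, he⟩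
  have hκ0 := Real.exp_pos (-T)
  have hQF : ∀ k, form X (g.1 *ᵥ Q.E k) = 0 ∧ form Y (g.1 *ᵥ Q.E k) = 0 ∧
      form f (g.1 *ᵥ Q.E k) = 0 := fun k => by
    have h1 : form (g.1 *ᵥ Q.v (-i)) (g.1 *ᵥ Q.E k) = 0 := by
      simpa [tripodFrame, (Fin.succ_ne_zero _).symm] using hB.orthonormal 0 k.succ.succ
    have h2 : form (g.1 *ᵥ perp Q.v (-i)) (g.1 *ᵥ Q.E k) = 0 := by
      simpa [tripodFrame, Fin.ext_iff] using hB.orthonormal 1 k.succ.succ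
    have hY : form Y (g.1 *ᵥ Q.E k) = 0 := by
      rw [hu, form_sub_left, hqF, form_smul_left, sub_zero] at h1
      exact (mul_eq_zero.1 h1).resolve_left hκ0.ne'
    have hf : form f (g.1 *ᵥ Q.E k) = 0 := by
      rw [hu', form_add_left, form_smul_left, hY] at h2; linarith
    have h3 := hqF k
    rw [hq, barycenter] at h3
    simp only [form_smul_left, form_add_left, hY, hf] at h3
    have h4 : Real.exp T * form X (g.1 *ᵥ Q.E k) = 0 := by linarith
    exact ⟨(mul_eq_zero.1 h4).resolve_left (Real.exp_pos T).ne', hY, hf⟩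
  have hs2 : ∀ k, s k ^ 2 = 1 := fun k => by simp only [hs]; split_ifs <;> simp [hσ]
  have hEE : ∀ k k', form (P.E k) (P.E k') = if k = k' then 1 else 0 := fun k k' => by
    simpa [tripodFrame] using (P.frame i).orthonormal k.succ.succ k'.succ.succ
  have hFF : ∀ k k', form (g.1 *ᵥ Q.E k) (g.1 *ᵥ Q.E k') = if k = k' then 1 else 0 :=
      fun k k' => by
    simpa [tripodFrame] using hB.orthonormal k.succ.succ k'.succ.succ
  have hξξ : form ξ ξ = ∑ k, b k ^ 2 := by
    simp only [hξ, form_sum_left, form_sum_right, form_smul_left, form_smul_right, hEE]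
    simp only [mul_ite, mul_one, mul_zero, Finset.sum_ite_eq', Finset.mem_univ, if_true]
    refine Finset.sum_congr rfl fun k _ => ?_
    linear_combination b k ^ 2 * hs2 k
  have hηη : form η η = ∑ k, b k ^ 2 := by
    simp only [hη, form_sum_left, form_sum_right, form_smul_left, form_smul_right, hFF]
    simp [sq]
  have hthird := h.transvection_normal (ξ := ξ) (η := η) hp hq hph hqh hT1
    (by rw [hξ, form_sum_right]; simp [hPE]) (by rw [hξ, form_sum_right]; simp [hPE])
    (by rw [hξ, form_sum_right]; simp [hPE]) (by rw [hη, form_sum_right]; simp [hQF])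
    (by rw [hη, form_sum_right]; simp [hQF]) (by rw [hη, form_sum_right]; simp [hQF]) hξξ hηη
  have hEFb := hEF b
  have hdiff : ∑ k, b k • (g.1 *ᵥ Q.E k - (if (k : ℕ) = 0 then σ else 1) • P.E k) = η - ξ := by
    rw [hη, hξ, ← Finset.sum_sub_distrib]
    exact Finset.sum_congr rfl fun k _ => smul_sub _ _ _
  rw [hdiff] at hEFb
  have ha' : a 0 ^ 2 + a 1 ^ 2 + ∑ k, b k ^ 2 = 1 := by
    rw [← ha, Fin.sum_univ_succ, Fin.sum_univ_succ, ← add_assoc]; rfl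
  have hb0 : 0 ≤ ∑ k, b k ^ 2 := Finset.sum_nonneg fun k _ => sq_nonneg _
  rw [hsplit]
  refine (form_add_add_self_le (by rw [hqh.1]; norm_num) hqh.2.ne'
    (by simp [hqu, hqM _ hpv]) (by simp [hqu', hqM _ hpv']) (by simp [hqη, hqM _ hpξ])).trans ?_
  simp only [form_smul_left (a 0), form_smul_right (a 0), form_smul_left (a 1),
    form_smul_right (a 1)]
  have t1 := mul_le_mul_of_nonneg_left (hfirst.trans
    (by linarith [sq_nonneg ε] : _ ≤ 12 * ε ^ 2)) (sq_nonneg (a 0))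
  have t2 := mul_le_mul_of_nonneg_left (hsecond.trans
    (by linarith [sq_nonneg ε] : _ ≤ 12 * ε ^ 2)) (sq_nonneg (a 1))
  have t3 : 2 * Real.exp (-T) * ∑ k, b k ^ 2 ≤ ε ^ 2 * ∑ k, b k ^ 2 :=
    mul_le_mul_of_nonneg_right (by linarith [sq_nonneg ε]) hb0
  have t4 : 36 * ε ^ 2 = 3 * (12 * ε ^ 2) * (a 0 ^ 2 + a 1 ^ 2 + ∑ k, b k ^ 2) := by
    rw [ha']; ring
  rw [t4]
  linarith

end Connection

/-! ### Fixed points of deck transformations -/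

section Axis

variable {n : ℕ}

/-- The null vector `p + w` represents the attracting fixed point of `g`. -/
theorem IsAxis.map_add {g : Matrix.SpecialLinearGroup (Fin (n + 1)) ℝ} {p w : Mink n} {l : ℝ}
    (h : IsAxis g p w l) : g.1 *ᵥ (p + w) = Real.exp l • (p + w) := by
  rw [Matrix.mulVec_add, h.map_base, h.map_dir, geo, geoVel, ← Real.cosh_add_sinh]
  module

/-- The null vector `p - w` represents the repelling fixed point of `g`. -/
theorem IsAxis.map_sub {g : Matrix.SpecialLinearGroup (Fin (n + 1)) ℝ} {p w : Mink n} {l : ℝ}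
    (h : IsAxis g p w l) : g.1 *ᵥ (p - w) = Real.exp (-l) • (p - w) := by
  rw [Matrix.mulVec_sub, h.map_base, h.map_dir, geo, geoVel, ← Real.cosh_sub_sinh]
  module

theorem IsUnitTangent.form_add_self {p w : Mink n} (hp : p ∈ hyp n) (h : IsUnitTangent p w) :
    form (p + w) (p + w) = 0 := by
  simp [hp.1, h.1, h.2, form_comm w p]

theorem IsUnitTangent.form_add_base {p w : Mink n} (hp : p ∈ hyp n) (h : IsUnitTangent p w) :
    form (p + w) p = -1 := by
  simp [hp.1, h.1, form_comm w p]

theorem IsUnitTangent.add_pos {p w : Mink n} (hp : p ∈ hyp n) (h : IsUnitTangent p w) :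
    0 < (p + w) 0 :=
  pos_of_form_neg hp (h.form_add_self hp).le (by rw [h.form_add_base hp]; norm_num)

theorem one_sub_sq_le_of_arccos_le {x ε : ℝ} (h1 : -1 ≤ x) (h2 : x ≤ 1)
    (h : Real.arccos x ≤ ε) : 1 - ε ^ 2 / 2 ≤ x := by
  have h3 := Real.one_sub_sq_div_two_le_cos (x := Real.arccos x)
  rw [Real.cos_arccos h1 h2] at h3
  have h4 := Real.arccos_nonneg x
  nlinarith

/-- An isometry with monodromy `ε`-close to the identity moves the vectors orthogonal to its
attracting fixed point by at most `ε`, modulo that fixed point. -/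
theorem IsAxis.form_map_sub_self_le {g : Matrix.SpecialLinearGroup (Fin (n + 1)) ℝ}
    {p w : Mink n} {l ε : ℝ} (hg : IsLorentz g.1) (h : IsAxis g p w l)
    (hε : ∀ v : Mink n, IsUnitTangent p v → form w v = 0 → angle v (g.1 *ᵥ v) ≤ ε) {v : Mink n}
    (hv : form (p + w) v = 0) :
    form (g.1 *ᵥ v - v) (g.1 *ᵥ v - v) ≤ ε ^ 2 * form v v := by
  have hN0 := h.unit.add_pos h.base
  have hNN := h.unit.form_add_self h.base
  set N := p + w with hN
  obtain ⟨a, v₀, hvv, hpv₀, hwv₀⟩ : ∃ (a : ℝ) (v₀ : Mink n), v = v₀ + a • N ∧ form p v₀ = 0 ∧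
      form w v₀ = 0 := by
    have h1 : form p v + form w v = 0 := by rw [← form_add_left]; exact hv
    refine ⟨-form p v, v - (-form p v) • N, by abel, ?_, ?_⟩
    · simp [hN, h.base.1, h.unit.1]
    · simp [hN, h.unit.1, h.unit.2, form_comm w p]; linarith
  have hNv₀ : form N v₀ = 0 := by rw [hN, form_add_left, hpv₀, hwv₀, add_zero]
  have hNg : ∀ x, form N x = 0 → form N (g.1 *ᵥ x) = 0 := fun x hx => by
    have h1 := hg N x
    rw [hx, h.map_add, form_smul_left] at h1
    exact (mul_eq_zero.1 h1).resolve_left (Real.exp_pos l).ne'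
  have key : form (g.1 *ᵥ v₀ - v₀) (g.1 *ᵥ v₀ - v₀) ≤ ε ^ 2 * form v₀ v₀ := by
    rcases (form_self_nonneg hNN.le hN0.ne' hNv₀).eq_or_lt with h0 | h0
    · rw [eq_zero_of_form_self (by rw [h.base.1]; norm_num) hpv₀ h0.symm]
      simp
    · have hr := Real.mul_self_sqrt h0.le
      have hr0 := Real.sqrt_pos.2 h0
      set r := Real.sqrt (form v₀ v₀)
      set v₁ := r⁻¹ • v₀ with hv₁
      have hv₀₁ : v₀ = r • v₁ := by rw [hv₁, smul_smul, mul_inv_cancel₀ hr0.ne', one_smul]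
      have h11 : form v₁ v₁ = 1 := by
        rw [hv₁, form_smul_left, form_smul_right, ← hr]; field_simp
      have hN1 : form N v₁ = 0 := by rw [hv₁, form_smul_right, hNv₀, mul_zero]
      have hsq := form_sq_le hNN.le hN0.ne' hN1 (hNg v₁ hN1)
      rw [hg, h11, one_mul] at hsq
      have habs := abs_le.1 ((sq_le_one_iff_abs_le_one _).1 hsq)
      have hx := one_sub_sq_le_of_arccos_le habs.1 habs.2
        (hε v₁ ⟨by rw [hv₁, form_smul_right, hpv₀, mul_zero], h11⟩
          (by rw [hv₁, form_smul_right, hwv₀, mul_zero]))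
      have h2 : form (g.1 *ᵥ v₁ - v₁) (g.1 *ᵥ v₁ - v₁) ≤ ε ^ 2 := by
        simp only [form_sub_left, form_sub_right, hg v₁ v₁, h11, form_comm (g.1 *ᵥ v₁) v₁]
        linarith
      rw [hv₀₁, Matrix.mulVec_smul, ← smul_sub]
      simp only [form_smul_left, form_smul_right, h11]
      nlinarith [mul_le_mul_of_nonneg_left h2 (mul_self_nonneg r)]
  have h3 : g.1 *ᵥ v - v = (g.1 *ᵥ v₀ - v₀) + (a * Real.exp l - a) • N := by
    rw [hvv, Matrix.mulVec_add, Matrix.mulVec_smul, h.map_add, smul_smul]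
    module
  have h4 : form N (g.1 *ᵥ v₀ - v₀) = 0 := by rw [form_sub_right, hNg v₀ hNv₀, hNv₀, sub_zero]
  have h5 : form v v = form v₀ v₀ := by
    rw [hvv]; simp [hNv₀, hNN, form_comm v₀ N]
  rw [h3, h5]
  refine le_of_eq_of_le ?_ key
  rw [form_add_left, form_add_right, form_add_right, form_smul_left, form_smul_left,
    form_smul_right, form_smul_right, form_comm _ N, h4, hNN]
  ring

end Axis

/-! ### Discreteness -/

section Discrete

variable {n : ℕ}

/-- The Lorentzian form is bounded by the positive definite form `form x x + 2 (form p x)²`. -/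
theorem abs_form_le_of_mem_hyp {p : Mink n} (hp : p ∈ hyp n) (x y : Mink n) :
    |form x y| ≤ (form x x + 2 * form p x ^ 2 + (form y y + 2 * form p y ^ 2)) / 2 := by
  have hpt : ∀ z, form p (z + form p z • p) = 0 := fun z => by
    rw [form_add_right, form_smul_right, hp.1]; ring
  have h1 := form_self_nonneg (by rw [hp.1]; norm_num) hp.2.ne' (hpt (x + y))
  have h2 := form_self_nonneg (by rw [hp.1]; norm_num) hp.2.ne' (hpt (x - y))
  simp only [form_add_left, form_add_right, form_sub_left, form_sub_right, form_smul_left,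
    form_smul_right, form_comm y x, form_comm x p, form_comm y p, hp.1] at h1 h2
  rw [abs_le]
  constructor <;> nlinarith [sq_nonneg (form p x + form p y), sq_nonneg (form p x - form p y)]

/-- The isometries that move `p` by a bounded distance have bounded matrix entries. -/
theorem exists_forall_abs_apply_le {p : Mink n} (hp : p ∈ hyp n) (D : ℝ) :
    ∃ C : ℝ, ∀ g ∈ SOplus n, |form p (g.1 *ᵥ p)| ≤ D → ∀ i j, |g.1 i j| ≤ C := by
  let E : Fin (n + 1) → Mink n := fun i => Pi.single i 1
  let q : Mink n → ℝ := fun x => form x x + 2 * form p x ^ 2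
  have hq : ∀ x, 0 ≤ q x := fun x => by
    have := (abs_nonneg _).trans (abs_form_le_of_mem_hyp hp x x)
    simp only [q]; linarith
  let B := ∑ i, q (E i)
  have hB : ∀ i, q (E i) ≤ B := fun i =>
    Finset.single_le_sum (f := fun i => q (E i)) (fun i _ => hq _) (Finset.mem_univ i)
  refine ⟨(B + (B + 2 * ((B + (2 * D ^ 2 + 1)) / 2) ^ 2)) / 2, fun g hg hD i j => ?_⟩
  have hgi : form p (g.1 *ᵥ E j) = form (g⁻¹.1 *ᵥ p) (E j) := by
    rw [← hg.1 (g⁻¹.1 *ᵥ p), Matrix.mulVec_mulVec, ← Matrix.SpecialLinearGroup.coe_mul,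
      mul_inv_cancel]
    simp
  have hinv : form p (g⁻¹.1 *ᵥ p) = form p (g.1 *ᵥ p) := by
    rw [← hg.1 p, Matrix.mulVec_mulVec, ← Matrix.SpecialLinearGroup.coe_mul, mul_inv_cancel,
      form_comm]
    simp
  have hinv' : form (g⁻¹.1 *ᵥ p) (g⁻¹.1 *ᵥ p) = -1 := by
    rw [((SOplus n).inv_mem hg).1, hp.1]
  have hD2 : form p (g.1 *ᵥ p) ^ 2 ≤ D ^ 2 :=
    sq_le_sq' (by linarith [abs_le.1 hD]) (abs_le.1 hD).2
  have h1 : |form p (g.1 *ᵥ E j)| ≤ (B + (2 * D ^ 2 + 1)) / 2 := by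
    rw [hgi]
    refine (abs_form_le_of_mem_hyp hp _ _).trans ?_
    rw [hinv, hinv']
    have := hB j
    simp only [q] at this
    linarith
  have h2 : form p (g.1 *ᵥ E j) ^ 2 ≤ ((B + (2 * D ^ 2 + 1)) / 2) ^ 2 :=
    sq_le_sq' (by linarith [abs_le.1 h1]) (abs_le.1 h1).2
  have h3 : |form (E i) (g.1 *ᵥ E j)| = |g.1 i j| := by
    refine Fin.cases ?_ (fun k => ?_) i
    · simp [form, E, Matrix.col]
    · simp [form, E, Matrix.col, Pi.single_apply]
  rw [← h3]
  refine (abs_form_le_of_mem_hyp hp _ _).trans ?_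
  have h4 := hB i
  have h5 := hB j
  rw [hg.1]
  simp only [q] at h4 h5
  have h6 : form (E j) (E j) ≤ B := by nlinarith [sq_nonneg (form p (E j))]
  linarith

/-- The group acts properly discontinuously: only finitely many elements move `p` by a bounded
distance. -/
theorem finite_setOf_abs_form_le {Γ : Subgroup (Matrix.SpecialLinearGroup (Fin (n + 1)) ℝ)}
    (hΓ : IsHyperbolicManifoldGroup Γ) {p : Mink n} (hp : p ∈ hyp n) (D : ℝ) :
    {g : Matrix.SpecialLinearGroup (Fin (n + 1)) ℝ | g ∈ Γ ∧ |form p (g.1 *ᵥ p)| ≤ D}.Finite := by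
  obtain ⟨C, hC⟩ := exists_forall_abs_apply_le hp D
  have := hΓ.discrete
  have hcl : IsClosed (Γ : Set (Matrix.SpecialLinearGroup (Fin (n + 1)) ℝ)) :=
    Subgroup.isClosed_of_discrete
  let K' : Set (Matrix (Fin (n + 1)) (Fin (n + 1)) ℝ) :=
    Set.univ.pi fun _ => Set.univ.pi fun _ => Set.Icc (-C) C
  let K : Set (Matrix.SpecialLinearGroup (Fin (n + 1)) ℝ) := Subtype.val ⁻¹' K'
  have hK : IsCompact K := by
    have hemb : Topology.IsClosedEmbedding
        (Subtype.val : Matrix.SpecialLinearGroup (Fin (n + 1)) ℝ → Matrix _ _ ℝ) :=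
      IsClosed.isClosedEmbedding_subtypeVal
        (isClosed_eq continuous_id.matrix_det continuous_const)
    have h1 : IsCompact K' := isCompact_univ_pi fun _ => isCompact_univ_pi fun _ => isCompact_Icc
    exact hemb.isCompact_preimage h1
  have hfin : (K ∩ Γ).Finite := by
    refine IsCompact.finite (hK.inter_right hcl) ?_
    exact (isDiscrete_iff_discreteTopology.2 this).mono Set.inter_subset_right
  refine hfin.subset fun g hg => ⟨fun i _ j _ => abs_le.1 (hC g (hΓ.isometries hg.1) hg.2 i j), hg.1⟩

/-- In a discrete group, an isometry that fixes the attracting fixed point of another one commutes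
with a power of it: its conjugates by the powers move a point of the axis by a bounded amount. -/
theorem exists_pow_commute {Γ : Subgroup (Matrix.SpecialLinearGroup (Fin (n + 1)) ℝ)}
    (hΓ : IsHyperbolicManifoldGroup Γ) {a b : Matrix.SpecialLinearGroup (Fin (n + 1)) ℝ}
    (ha : a ∈ Γ) (hb : b ∈ Γ) {p w : Mink n} {l μ : ℝ} (h : IsAxis a p w l)
    (hbN : b.1 *ᵥ (p + w) = μ • (p + w)) : ∃ m : ℕ, 0 < m ∧ Commute (a ^ m) b := by
  have hNN := h.unit.form_add_self h.base
  set N := p + w with hN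
  set N' := p - w with hN'
  have hpN : p = (1 / 2 : ℝ) • (N + N') := by
    rw [hN, hN', add_add_sub_cancel, ← two_smul ℝ, smul_smul]; norm_num
  have hpow : ∀ k : ℕ, (a ^ k).1 *ᵥ N = Real.exp l ^ k • N ∧
      (a ^ k).1 *ᵥ N' = Real.exp (-l) ^ k • N' := fun k => by
    induction k with
    | zero => simp
    | succ k ih =>
      rw [pow_succ, Matrix.SpecialLinearGroup.coe_mul, ← Matrix.mulVec_mulVec,
        ← Matrix.mulVec_mulVec, h.map_add, h.map_sub, Matrix.mulVec_smul, Matrix.mulVec_smul,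
        ih.1, ih.2, smul_smul, smul_smul, pow_succ', pow_succ']
      exact ⟨rfl, rfl⟩
  let D := |form N (b.1 *ᵥ N')| + |μ * form N' N| + |form N' (b.1 *ᵥ N')|
  let f : ℕ → Matrix.SpecialLinearGroup (Fin (n + 1)) ℝ := fun k => (a ^ k)⁻¹ * b * a ^ k
  have hmem : ∀ k, f k ∈ {g | g ∈ Γ ∧ |form p (g.1 *ᵥ p)| ≤ D} := fun k => by
    refine ⟨Γ.mul_mem (Γ.mul_mem (Γ.inv_mem (Γ.pow_mem ha k)) hb) (Γ.pow_mem ha k), ?_⟩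
    have h1 : form p ((f k).1 *ᵥ p) = form ((a ^ k).1 *ᵥ p) (b.1 *ᵥ ((a ^ k).1 *ᵥ p)) := by
      rw [← (hΓ.isometries (Γ.pow_mem ha k)).1 p, Matrix.mulVec_mulVec, Matrix.mulVec_mulVec,
        ← Matrix.SpecialLinearGroup.coe_mul, ← Matrix.SpecialLinearGroup.coe_mul]
      simp only [f]
      rw [mul_assoc, mul_inv_cancel_left]
    have hexp : Real.exp l ^ k * Real.exp (-l) ^ k = 1 := by
      rw [← mul_pow, ← Real.exp_add, add_neg_cancel, Real.exp_zero, one_pow]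
    have hle : Real.exp (-l) ^ k ≤ 1 :=
      pow_le_one₀ (Real.exp_pos _).le (Real.exp_le_one_iff.2 (by linarith [h.pos]))
    have hge : 0 ≤ Real.exp (-l) ^ k := by positivity
    rw [h1]
    conv_lhs => rw [hpN]
    rw [Matrix.mulVec_smul, Matrix.mulVec_add, (hpow k).1, (hpow k).2, Matrix.mulVec_smul,
      Matrix.mulVec_add, Matrix.mulVec_smul, Matrix.mulVec_smul, hbN]
    generalize Real.exp l ^ k = x at *
    generalize Real.exp (-l) ^ k = y at *
    simp only [form_smul_left, form_smul_right, form_add_left, form_add_right, hNN]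
    have h2 : 1 / 2 * (1 / 2 * (x * (x * (μ * 0)) + y * (x * (μ * form N' N)) +
        (x * (y * form N (b.1 *ᵥ N')) + y * (y * form N' (b.1 *ᵥ N'))))) =
        1 / 4 * (form N (b.1 *ᵥ N') + μ * form N' N + y ^ 2 * form N' (b.1 *ᵥ N')) := by
      linear_combination (1 / 4 * (form N (b.1 *ᵥ N') + μ * form N' N)) * hexp
    have hy : |y ^ 2 * form N' (b.1 *ᵥ N')| ≤ |form N' (b.1 *ᵥ N')| := by
      rw [abs_mul, abs_of_nonneg (sq_nonneg y)]
      exact mul_le_of_le_one_left (abs_nonneg _) (pow_le_one₀ hge hle)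
    have h3 := abs_add_three (form N (b.1 *ᵥ N')) (μ * form N' N)
      (y ^ 2 * form N' (b.1 *ᵥ N'))
    have h4 : |1 / 4 * (form N (b.1 *ᵥ N') + μ * form N' N + y ^ 2 * form N' (b.1 *ᵥ N'))| ≤ D := by
      rw [abs_mul, abs_of_nonneg (by norm_num : (0 : ℝ) ≤ 1 / 4)]
      have := abs_nonneg (form N (b.1 *ᵥ N') + μ * form N' N + y ^ 2 * form N' (b.1 *ᵥ N'))
      simp only [D]
      linarith
    rw [← h2] at h4
    convert h4 using 2
    ring
  have hfin := finite_setOf_abs_form_le hΓ h.base D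
  obtain ⟨i, j, hij, hf⟩ : ∃ i j, i < j ∧ f i = f j := by
    by_contra hcon
    push Not at hcon
    have hinj : Function.Injective f := fun i j hij => by
      rcases lt_trichotomy i j with h1 | h1 | h1
      · exact absurd hij (hcon i j h1)
      · exact h1
      · exact absurd hij.symm (hcon j i h1)
    exact Set.infinite_of_injective_forall_mem hinj hmem hfin
  refine ⟨j - i, by omega, ?_⟩
  have hpw : a ^ j = a ^ (j - i) * a ^ i := by rw [← pow_add]; congr 1; omega
  have h1 : (a ^ i)⁻¹ * b * a ^ i = (a ^ j)⁻¹ * b * a ^ j := hf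
  rw [hpw] at h1
  generalize a ^ (j - i) = x at *
  have h2 : b = x⁻¹ * b * x := by
    calc b = a ^ i * ((a ^ i)⁻¹ * b * a ^ i) * (a ^ i)⁻¹ := by group
      _ = a ^ i * ((x * a ^ i)⁻¹ * b * (x * a ^ i)) * (a ^ i)⁻¹ := by rw [h1]
      _ = _ := by group
  have h3 : x * b = b * x := by
    conv_lhs => rw [h2]
    group
  exact h3

/-- The free group acts on `ℤ` with one generator acting as a shift and the other one as a
transposition. -/
theorem freeGroup_of_pow_not_commute {m : ℕ} (hm : 0 < m) {i j : Fin 2} (hij : i ≠ j) :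
    ¬ Commute (FreeGroup.of i ^ m) (FreeGroup.of j) := by
  intro h
  let φ : FreeGroup (Fin 2) →* Equiv.Perm ℤ :=
    FreeGroup.lift fun k => if k = i then Equiv.addRight 1 else Equiv.swap 0 1
  have h1 := h.map φ
  rw [map_pow, FreeGroup.lift_apply_of, FreeGroup.lift_apply_of, if_pos rfl, if_neg hij.symm] at h1
  have h2 := DFunLike.congr_fun h1.eq 0
  have hpow : ∀ (k : ℕ) (x : ℤ), (Equiv.addRight (1 : ℤ) ^ k) x = x + k := fun k => by
    induction k with
    | zero => simp
    | succ k ih => intro x; rw [pow_succ, Equiv.Perm.mul_apply, ih]; simp; ring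
  simp only [Equiv.Perm.mul_apply, Equiv.swap_apply_left, hpow, zero_add] at h2
  rw [Equiv.swap_apply_def] at h2
  split_ifs at h2 <;> omega

theorem cuff_pow_not_commute {m : ℕ} (hm : 0 < m) {i j : Fin 3} (hij : i < j) :
    ¬ Commute (cuff i ^ m) (cuff j) := by
  have h01 : ¬ Commute (FreeGroup.of (0 : Fin 2) ^ m) (FreeGroup.of 1) :=
    freeGroup_of_pow_not_commute hm (by decide)
  have h10 : ¬ Commute (FreeGroup.of (1 : Fin 2) ^ m) (FreeGroup.of 0) :=
    freeGroup_of_pow_not_commute hm (by decide)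
  fin_cases i <;> fin_cases j <;> simp [cuff] at hij ⊢
  · exact h01
  · intro h
    rw [← mul_inv_rev, Commute.inv_right_iff] at h
    refine h01 ?_
    have := ((Commute.refl (FreeGroup.of (0 : Fin 2))).pow_left m).inv_right.mul_right h
    rwa [inv_mul_cancel_left] at this
  · intro h
    rw [← mul_inv_rev, Commute.inv_right_iff] at h
    refine h10 ?_
    have := h.mul_right ((Commute.refl (FreeGroup.of (1 : Fin 2))).pow_left m).inv_right
    rwa [mul_inv_cancel_right] at this

end Discrete

/-! ### Ideal triangles -/

section IdealTriangle

variable {n : ℕ}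

/-- The future null vectors `V 0, V 1, V 2` represent the vertices of an ideal triangle, scaled so
that their barycenter is at the same distance from the three corresponding horospheres. -/
structure IsIdealTriangle (V : Fin 3 → Mink n) : Prop where
  null : ∀ i, form (V i) (V i) = 0
  pos : ∀ i, 0 < V i 0
  form_eq : ∀ i j, i ≠ j → form (V i) (V j) = -3 / 2

/-- The barycenter of the ideal triangle with vertices `V`. -/
noncomputable def center (V : Fin 3 → Mink n) : Mink n := (1 / 3 : ℝ) • (V 0 + V 1 + V 2)

/-- The unit normal of the edge opposite to the vertex `V i`, in the plane of the ideal triangle and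
pointing into it. -/
noncomputable def normal (V : Fin 3 → Mink n) (i : Fin 3) : Mink n :=
  (Real.sqrt 3)⁻¹ • (V i - V (i + 1) - V (i + 2))

theorem center_eq (V : Fin 3 → Mink n) (i : Fin 3) :
    center V = (1 / 3 : ℝ) • (V i + V (i + 1) + V (i + 2)) := by
  rw [center]
  congr 1
  fin_cases i <;> simp <;> abel

theorem sqrt_three_smul_normal (V : Fin 3 → Mink n) (i : Fin 3) :
    Real.sqrt 3 • normal V i = V i - V (i + 1) - V (i + 2) := by
  rw [normal, smul_smul, mul_inv_cancel₀ (Real.sqrt_pos.2 (by norm_num)).ne', one_smul]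

theorem inv_sqrt_three_mul_self : (Real.sqrt 3)⁻¹ * (Real.sqrt 3)⁻¹ = 1 / 3 := by
  rw [← mul_inv, Real.mul_self_sqrt (by norm_num)]; norm_num

theorem IsIdealTriangle.form_normal {V : Fin 3 → Mink n} (h : IsIdealTriangle V) (i : Fin 3) :
    form (V (i + 1)) (normal V i) = 0 ∧ form (V (i + 2)) (normal V i) = 0 ∧
      form (normal V i) (normal V i) = 1 := by
  have h12 : i + 1 ≠ i + 2 := (by decide : ∀ i : Fin 3, i + 1 ≠ i + 2) i
  have h01 : i ≠ i + 1 := (by decide : ∀ i : Fin 3, i ≠ i + 1) i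
  have h02 : i ≠ i + 2 := (by decide : ∀ i : Fin 3, i ≠ i + 2) i
  simp only [normal, form_smul_left, form_smul_right, form_sub_left, form_sub_right, h.null,
    h.form_eq _ _ h12, h.form_eq _ _ h12.symm, h.form_eq _ _ h01, h.form_eq _ _ h01.symm,
    h.form_eq _ _ h02, h.form_eq _ _ h02.symm]
  exact ⟨by ring, by ring, by linear_combination 3 * inv_sqrt_three_mul_self⟩

theorem IsIdealTriangle.form_center {V : Fin 3 → Mink n} (h : IsIdealTriangle V) (i : Fin 3) :
    form (center V) (V i) = -1 := by
  have h01 : i ≠ i + 1 := (by decide : ∀ i : Fin 3, i ≠ i + 1) i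
  have h02 : i ≠ i + 2 := (by decide : ∀ i : Fin 3, i ≠ i + 2) i
  rw [center_eq V i]
  simp only [form_smul_left, form_add_left, h.null, h.form_eq _ _ h01.symm, h.form_eq _ _ h02.symm]
  norm_num

theorem IsIdealTriangle.center_mem {V : Fin 3 → Mink n} (h : IsIdealTriangle V) :
    center V ∈ hyp n := by
  refine ⟨?_, ?_⟩
  · have h1 : ∀ x, form x (center V) = 1 / 3 * (form x (V 0) + form x (V 1) + form x (V 2)) :=
      fun x => by simp only [center, form_smul_right, form_add_right]
    rw [h1, h.form_center, h.form_center, h.form_center]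
    norm_num
  · have h0 := h.pos 0
    have h1 := h.pos 1
    have h2 := h.pos 2
    simp only [center, Pi.smul_apply, Pi.add_apply, smul_eq_mul]
    positivity

theorem IsIdealTriangle.exists_framedTripod {d : ℕ} (hd : 1 ≤ d) {V : Fin 3 → Mink (d + 2)}
    (h : IsIdealTriangle V) :
    ∃ P : FramedTripod d, P.base = center V ∧ ∀ j, P.v j = V (j + 2) - center V := by
  have hcc := h.center_mem
  obtain ⟨P, hP, hPv⟩ := HypPants.exists_framedTripod hd (v := fun j => V (j + 2) - center V)
    hcc (fun i => ⟨by rw [form_sub_right, h.form_center, hcc.1]; ring, by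
      simp only [form_sub_left, form_sub_right, h.form_center, hcc.1, h.null,
        form_comm _ (center V)]; ring⟩)
    (fun i j hij => by
      simp only [form_sub_left, form_sub_right, h.form_center, hcc.1,
        h.form_eq (i + 2) (j + 2) (by simpa using hij), form_comm _ (center V)]
      ring)
    (by
      show V 2 - center V + (V 0 - center V) + (V 1 - center V) = 0
      have : (3 : ℝ) • center V = V 0 + V 1 + V 2 := by
        rw [center, smul_smul]; norm_num
      calc _ = (V 0 + V 1 + V 2) - (3 : ℝ) • center V := by module
        _ = 0 := by rw [this, sub_self])
  exact ⟨P, hP, fun j => by rw [hPv]⟩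

theorem SOplus.map_pos {g : Matrix.SpecialLinearGroup (Fin (n + 1)) ℝ} (hg : g ∈ SOplus n)
    {N : Mink n} (hN : form N N = 0) (hN0 : 0 < N 0) : 0 < (g.1 *ᵥ N) 0 := by
  have he : (Pi.single 0 1 : Mink n) ∈ hyp n := ⟨by simp [form_single], by simp⟩
  refine pos_of_form_neg ((hg.2 _).2 he) (by rw [hg.1, hN]) ?_
  rw [hg.1]
  simp [form, Fin.succ_ne_zero, hN0]

end IdealTriangle

/-! ### Spinning a pair of pants around its cuffs -/

section Pants

variable {n : ℕ}

/-- The isometries `c 0`, `c 1`, `c 2` generate a pair of pants; `V i` is the attracting fixed point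
of `c i` and `l i` its translation length, and `c i` moves the vectors orthogonal to `V i` by at most
`ε`, modulo `V i`. The ideal triangle `V` is one of the two triangles of the pants that spin around
its cuffs. -/
structure IsSpunTriangle (c : Fin 3 → Matrix.SpecialLinearGroup (Fin (n + 1)) ℝ)
    (V : Fin 3 → Mink n) (l : Fin 3 → ℝ) (ε : ℝ) : Prop extends IsIdealTriangle V where
  isometry : ∀ i, c i ∈ SOplus n
  mul_eq_one : c 0 * c 1 * c 2 = 1
  map : ∀ i, (c i).1 *ᵥ V i = Real.exp (l i) • V i
  monodromy : ∀ i v, form (V i) v = 0 →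
    form ((c i).1 *ᵥ v - v) ((c i).1 *ᵥ v - v) ≤ ε ^ 2 * form v v

/-- The shear along the edge opposite to the `i`-th vertex. -/
noncomputable def shear (l : Fin 3 → ℝ) (i : Fin 3) : ℝ := (l (i + 1) + l (i + 2) - l i) / 2

/-- The deck transformations that carry the second triangle of the pants to the triangle that
is adjacent to the first one at its `i`-th edge. -/
def connector (c : Fin 3 → Matrix.SpecialLinearGroup (Fin (n + 1)) ℝ) :
    Fin 3 → Matrix.SpecialLinearGroup (Fin (n + 1)) ℝ := ![(c 1)⁻¹, c 0, 1]

/-- The second ideal triangle of the pants. It shares the edge from `V 0` to `V 1` with the first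
one, and its third vertex is the attracting fixed point of `c 1 * c 2 * (c 1)⁻¹`. -/
noncomputable def opposite (c : Fin 3 → Matrix.SpecialLinearGroup (Fin (n + 1)) ℝ)
    (V : Fin 3 → Mink n) (l : Fin 3 → ℝ) : Fin 3 → Mink n :=
  ![Real.exp (shear l 2) • V 1, Real.exp (-shear l 2) • V 0,
    Real.exp (shear l 0) • (c 1).1 *ᵥ V 2]

/-- The normal of the `i`-th edge that points into the adjacent copy of the second triangle. -/
noncomputable def oppositeNormal (c : Fin 3 → Matrix.SpecialLinearGroup (Fin (n + 1)) ℝ)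
    (V : Fin 3 → Mink n) (l : Fin 3 → ℝ) (i : Fin 3) : Mink n :=
  (connector c i).1 *ᵥ normal (opposite c V l) (1 - i)

variable {c : Fin 3 → Matrix.SpecialLinearGroup (Fin (n + 1)) ℝ} {V : Fin 3 → Mink n}
  {l : Fin 3 → ℝ} {ε : ℝ}

theorem IsSpunTriangle.connector_mul_inv (h : IsSpunTriangle c V l ε) (i : Fin 3) :
    connector c (i + 1) * (connector c (i - 1))⁻¹ = c i := by
  have h3 : c 2 = (c 1)⁻¹ * (c 0)⁻¹ := by
    rw [← mul_inv_rev]; exact eq_inv_of_mul_eq_one_right h.mul_eq_one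
  fin_cases i
  · show c 0 * 1⁻¹ = c 0
    simp
  · show 1 * ((c 1)⁻¹)⁻¹ = c 1
    simp
  · exact h3.symm

theorem IsSpunTriangle.connector_mem (h : IsSpunTriangle c V l ε) (i : Fin 3) :
    connector c i ∈ SOplus n := by
  fin_cases i
  exacts [(SOplus n).inv_mem (h.isometry 1), h.isometry 0, (SOplus n).one_mem]

theorem inv_mulVec_mulVec (g : Matrix.SpecialLinearGroup (Fin (n + 1)) ℝ) (x : Mink n) :
    (g⁻¹).1 *ᵥ (g.1 *ᵥ x) = x := by
  rw [Matrix.mulVec_mulVec, ← Matrix.SpecialLinearGroup.coe_mul, inv_mul_cancel]; simp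

theorem IsSpunTriangle.inv_map (h : IsSpunTriangle c V l ε) (i : Fin 3) :
    ((c i)⁻¹).1 *ᵥ V i = Real.exp (-l i) • V i := by
  have h1 := inv_mulVec_mulVec (c i) (V i)
  rw [h.map, Matrix.mulVec_smul] at h1
  rw [← h1, smul_smul, ← Real.exp_add, neg_add_cancel, Real.exp_zero, one_smul, h1]

/-- The copies of the two triangles that are adjacent along the `i`-th edge. -/
theorem IsSpunTriangle.connector_opposite (h : IsSpunTriangle c V l ε) (i : Fin 3) :
    (connector c i).1 *ᵥ opposite c V l (-i) = Real.exp (-shear l i) • V (i + 1) ∧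
    (connector c i).1 *ᵥ opposite c V l (-i + 2) = Real.exp (shear l i) • V (i + 2) := by
  have h3 : c 0 * c 1 = (c 2)⁻¹ := eq_inv_of_mul_eq_one_left h.mul_eq_one
  fin_cases i
  · constructor
    · show ((c 1)⁻¹).1 *ᵥ (Real.exp (shear l 2) • V 1) = Real.exp (-shear l 0) • V 1
      rw [Matrix.mulVec_smul, h.inv_map, smul_smul, ← Real.exp_add]
      congr 2
      show (l 0 + l 1 - l 2) / 2 + -l 1 = -((l 1 + l 2 - l 0) / 2)
      ring
    · show ((c 1)⁻¹).1 *ᵥ (Real.exp (shear l 0) • (c 1).1 *ᵥ V 2) = Real.exp (shear l 0) • V 2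
      rw [Matrix.mulVec_smul, inv_mulVec_mulVec]
  · constructor
    · show (c 0).1 *ᵥ (Real.exp (shear l 0) • (c 1).1 *ᵥ V 2) = Real.exp (-shear l 1) • V 2
      rw [Matrix.mulVec_smul, Matrix.mulVec_mulVec, ← Matrix.SpecialLinearGroup.coe_mul, h3,
        h.inv_map, smul_smul, ← Real.exp_add]
      congr 2
      show (l 1 + l 2 - l 0) / 2 + -l 2 = -((l 2 + l 0 - l 1) / 2)
      ring
    · show (c 0).1 *ᵥ (Real.exp (-shear l 2) • V 0) = Real.exp (shear l 1) • V 0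
      rw [Matrix.mulVec_smul, h.map, smul_smul, ← Real.exp_add]
      congr 2
      show -((l 0 + l 1 - l 2) / 2) + l 0 = (l 2 + l 0 - l 1) / 2
      ring
  · constructor
    · show (1 : Matrix.SpecialLinearGroup (Fin (n + 1)) ℝ).1 *ᵥ (Real.exp (-shear l 2) • V 0) =
        Real.exp (-shear l 2) • V 0
      simp
    · show (1 : Matrix.SpecialLinearGroup (Fin (n + 1)) ℝ).1 *ᵥ (Real.exp (shear l 2) • V 1) =
        Real.exp (shear l 2) • V 1
      simp

theorem IsSpunTriangle.isIdealTriangle_opposite (h : IsSpunTriangle c V l ε) :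
    IsIdealTriangle (opposite c V l) := by
  have hnull : ∀ i, form (opposite c V l (-i)) (opposite c V l (-i)) = 0 := fun i => by
    rw [← (h.connector_mem i).1, (h.connector_opposite i).1]
    simp [h.null]
  have hform : ∀ i, form (opposite c V l (-i)) (opposite c V l (-i + 2)) = -3 / 2 := fun i => by
    rw [← (h.connector_mem i).1, (h.connector_opposite i).1, (h.connector_opposite i).2,
      form_smul_left, form_smul_right,
      h.form_eq _ _ ((by decide : ∀ i : Fin 3, i + 1 ≠ i + 2) i), ← mul_assoc, ← Real.exp_add]
    simp
  refine ⟨fun i => by simpa using hnull (-i), fun i => ?_, fun i j hij => ?_⟩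
  · fin_cases i
    · exact mul_pos (Real.exp_pos _) (h.pos 1)
    · exact mul_pos (Real.exp_pos _) (h.pos 0)
    · exact mul_pos (Real.exp_pos _) (SOplus.map_pos (h.isometry 1) (h.null 2) (h.pos 2))
  · rcases (by decide : ∀ i j : Fin 3, i ≠ j → j = i + 2 ∨ i = j + 2) i j hij with rfl | rfl
    · simpa using hform (-i)
    · rw [form_comm]; simpa using hform (-j)

/-- The third vertex of the triangle that is adjacent along the `i`-th edge. -/
theorem IsSpunTriangle.connector_opposite_self (h : IsSpunTriangle c V l ε) (i : Fin 3) :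
    (connector c i).1 *ᵥ opposite c V l (1 - i) = Real.exp (shear l i) • V (i + 2) +
      Real.exp (-shear l i) • V (i + 1) + Real.sqrt 3 • oppositeNormal c V l i := by
  rw [← (h.connector_opposite i).1, ← (h.connector_opposite i).2, oppositeNormal,
    ← Matrix.mulVec_smul, sqrt_three_smul_normal, ← Matrix.mulVec_add, ← Matrix.mulVec_add,
    (by decide : ∀ i : Fin 3, 1 - i + 1 = -i + 2) i, (by decide : ∀ i : Fin 3, 1 - i + 2 = -i) i]
  congr 1
  abel

theorem IsSpunTriangle.isEdge (h : IsSpunTriangle c V l ε) (i : Fin 3) :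
    IsEdge (V (i + 2)) (V (i + 1)) (normal V i) (oppositeNormal c V l i) := by
  have hn := h.form_normal i
  have hU := h.isIdealTriangle_opposite.form_normal (1 - i)
  rw [(by decide : ∀ i : Fin 3, 1 - i + 1 = -i + 2) i,
    (by decide : ∀ i : Fin 3, 1 - i + 2 = -i) i] at hU
  have hg := (h.connector_mem i).1
  refine ⟨h.null _, h.null _, h.form_eq _ _ ((by decide : ∀ i : Fin 3, i + 2 ≠ i + 1) i), hn.2.1,
    hn.1, ?_, ?_, hn.2.2, by rw [oppositeNormal, hg, hU.2.2]⟩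
  · have := hU.1
    rw [← hg, (h.connector_opposite i).2, form_smul_left] at this
    exact (mul_eq_zero.1 this).resolve_left (Real.exp_pos _).ne'
  · have := hU.2.1
    rw [← hg, (h.connector_opposite i).1, form_smul_left] at this
    exact (mul_eq_zero.1 this).resolve_left (Real.exp_pos _).ne'

/-- The normals of the two edges at a vertex are opposite, modulo the vertex. -/
theorem normal_succ (V : Fin 3 → Mink n) (i : Fin 3) :
    ∃ α : ℝ, normal V (i + 1) = -normal V (i + 2) + α • V i := by
  refine ⟨-2 * (Real.sqrt 3)⁻¹, ?_⟩
  rw [normal, normal, (by decide : ∀ i : Fin 3, i + 1 + 1 = i + 2) i,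
    (by decide : ∀ i : Fin 3, i + 1 + 2 = i) i, (by decide : ∀ i : Fin 3, i + 2 + 1 = i) i,
    (by decide : ∀ i : Fin 3, i + 2 + 2 = i + 1) i]
  module

/-- The adjacent triangles at the vertex `V i` are related by `c i`. Hence so are their normals, up to
the sign that comes from `normal_succ`. -/
theorem IsSpunTriangle.oppositeNormal_succ (h : IsSpunTriangle c V l ε) (i : Fin 3) :
    ∃ α : ℝ, oppositeNormal c V l (i + 1) = -((c i).1 *ᵥ oppositeNormal c V l (i + 2)) + α • V i := by
  obtain ⟨α, hα⟩ := normal_succ (opposite c V l) (1 - i)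
  refine ⟨α * Real.exp (shear l (i + 1)), ?_⟩
  have h1 : (c i).1 *ᵥ oppositeNormal c V l (i + 2) =
      (connector c (i + 1)).1 *ᵥ normal (opposite c V l) (1 - i + 1) := by
    rw [oppositeNormal, Matrix.mulVec_mulVec, ← Matrix.SpecialLinearGroup.coe_mul,
      (by decide : ∀ i : Fin 3, 1 - (i + 2) = 1 - i + 1) i, ← h.connector_mul_inv i,
      (by decide : ∀ i : Fin 3, i - 1 = i + 2) i, inv_mul_cancel_right]
  have h2 := (h.connector_opposite (i + 1)).2
  rw [(by decide : ∀ i : Fin 3, -(i + 1) + 2 = 1 - i) i,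
    (by decide : ∀ i : Fin 3, i + 1 + 2 = i) i] at h2
  rw [h1, hα, oppositeNormal,
    (by decide : ∀ i : Fin 3, 1 - (i + 1) = 1 - i + 2) i, Matrix.mulVec_add, Matrix.mulVec_smul, h2,
    Matrix.mulVec_neg]
  module

/-- A vector normal to the first triangle pairs with the normals of adjacent triangles
with almost alternating signs; as there are three edges, all of these pairings are small. -/
theorem IsSpunTriangle.form_oppositeNormal_sq_le (h : IsSpunTriangle c V l ε) {ξ : Mink n}
    (hξ : ∀ i, form (V i) ξ = 0) (j : Fin 3) :
    form ξ (oppositeNormal c V l j) ^ 2 ≤ 9 / 4 * ε ^ 2 * form ξ ξ := by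
  have key : ∀ i, (form ξ (oppositeNormal c V l (i + 1)) +
      form ξ (oppositeNormal c V l (i + 2))) ^ 2 ≤ ε ^ 2 * form ξ ξ := fun i => by
    obtain ⟨α, hα⟩ := h.oppositeNormal_succ i
    have hE := h.isEdge (i + 2)
    rw [(by decide : ∀ i : Fin 3, i + 2 + 1 = i) i] at hE
    set f := oppositeNormal c V l (i + 2)
    have hm := h.monodromy i f hE.Yf
    rw [hE.ff, mul_one] at hm
    have hNc : form (V i) ((c i).1 *ᵥ f) = 0 := by
      have h1 := (h.isometry i).1 (V i) f
      rw [h.map, form_smul_left, hE.Yf] at h1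
      exact (mul_eq_zero.1 h1).resolve_left (Real.exp_pos _).ne'
    have hcs := form_sq_le (h.null i).le (h.pos i).ne' (hξ i)
      (y := (c i).1 *ᵥ f - f) (by rw [form_sub_right, hNc, hE.Yf, sub_zero])
    have hξξ := form_self_nonneg (h.null i).le (h.pos i).ne' (hξ i)
    have : form ξ (oppositeNormal c V l (i + 1)) + form ξ f = -form ξ ((c i).1 *ᵥ f - f) := by
      rw [hα]
      simp only [form_add_right, form_neg_right, form_smul_right, form_comm ξ (V i), hξ,
        form_sub_right]
      ring
    rw [this, neg_sq]
    calc _ ≤ _ := hcs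
      _ ≤ form ξ ξ * ε ^ 2 := mul_le_mul_of_nonneg_left hm hξξ
      _ = _ := mul_comm _ _
  have h0 := key j
  have h1 := key (j + 1)
  have h2 := key (j + 2)
  rw [(by decide : ∀ i : Fin 3, i + 1 + 1 = i + 2) j,
    (by decide : ∀ i : Fin 3, i + 1 + 2 = i) j] at h1
  rw [(by decide : ∀ i : Fin 3, i + 2 + 1 = i) j,
    (by decide : ∀ i : Fin 3, i + 2 + 2 = i + 1) j] at h2
  -- `2x = (x + y) + (z + x) - (y + z)`, and each of the sums is small.
  generalize form ξ (oppositeNormal c V l j) = x at *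
  generalize form ξ (oppositeNormal c V l (j + 1)) = y at *
  generalize form ξ (oppositeNormal c V l (j + 2)) = z at *
  nlinarith [sq_nonneg ((x + y) - (z + x)), sq_nonneg ((x + y) + (y + z)),
    sq_nonneg ((z + x) + (y + z))]

/-- The normals of adjacent triangles are almost parallel: the component of the normal of the second
triangle that is normal to the first triangle is small. -/
theorem IsSpunTriangle.one_sub_form_normal_sq_le (h : IsSpunTriangle c V l ε) (j : Fin 3) :
    1 - form (normal V j) (oppositeNormal c V l j) ^ 2 ≤ 9 / 4 * ε ^ 2 := by
  have hE := h.isEdge j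
  have hV : V j = V (j + 1) + V (j + 2) + Real.sqrt 3 • normal V j := by
    rw [sqrt_three_smul_normal]; abel
  have hr := h.form_oppositeNormal_sq_le (j := j)
    (ξ := oppositeNormal c V l j - form (normal V j) (oppositeNormal c V l j) • normal V j)
  have habs := hE.abs_form_le
  generalize oppositeNormal c V l j = f at *
  generalize normal V j = e at *
  have hξ : ∀ i, form (V i) (f - form e f • e) = 0 := fun i => by
    have h1 : form (V (j + 1)) (f - form e f • e) = 0 := by simp [hE.Ye, hE.Yf]
    have h2 : form (V (j + 2)) (f - form e f • e) = 0 := by simp [hE.Xe, hE.Xf]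
    have h3 : form e (f - form e f • e) = 0 := by simp [hE.ee]
    have h0 : form (V j) (f - form e f • e) = 0 := by
      rw [hV, form_add_left, form_add_left, h1, h2, form_smul_left, h3]; ring
    rcases (by decide : ∀ i j : Fin 3, i = j ∨ i = j + 1 ∨ i = j + 2) i j with rfl | rfl | rfl
    exacts [h0, h1, h2]
  have h1 := hr hξ
  have h2 : form (f - form e f • e) f = 1 - form e f ^ 2 := by
    rw [form_sub_left, form_smul_left, hE.ff]; ring
  have h3 : form (f - form e f • e) (f - form e f • e) = 1 - form e f ^ 2 := by
    simp only [form_sub_left, form_sub_right, form_smul_left, form_smul_right, hE.ff, hE.ee,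
      form_comm f e]
    ring
  rw [h2, h3] at h1
  have h4 : 0 ≤ 1 - form e f ^ 2 := by
    have := (sq_le_one_iff_abs_le_one _).2 habs; linarith
  rcases h4.eq_or_lt with h5 | h5
  · rw [← h5]; positivity
  · rw [sq (1 - form e f ^ 2)] at h1
    exact le_of_mul_le_mul_right h1 h5

/-- An orientation preserving isometry that carries the first triangle at an edge to the second one,
exchanging the ends of the edge, and that is close to a diagonal matrix of signs on the normal
vectors `E`. Here `σ = 1` if the triangles are almost unfolded along the edge (`f` is close to `-e`)
and `σ = -1` if they are folded over each other (`f` is close to `e`). In the second case, `E 0` has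
to be reflected in order to preserve the orientation. -/
theorem exists_lorentz_of_isEdge {d : ℕ} (hd : 1 ≤ d) {X Y e f : Mink n} {T σ : ℝ}
    {E : Fin d → Mink n} (hσ : σ = 1 ∨ σ = -1) (h : IsEdge X Y e f) (hr : σ * form e f ≤ 0)
    (hE : ∀ k k', form (E k) (E k') = if k = k' then 1 else 0)
    (hXE : ∀ k, form X (E k) = 0) (hYE : ∀ k, form Y (E k) = 0) (heE : ∀ k, form e (E k) = 0) :
    ∃ L : Matrix (Fin (n + 1)) (Fin (n + 1)) ℝ, IsLorentz L ∧ 0 < L.det ∧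
      L *ᵥ X = Real.exp (-T) • Y ∧ L *ᵥ Y = Real.exp T • X ∧ L *ᵥ e = f ∧
      ∀ k, L *ᵥ E k = (if (k : ℕ) = 0 then σ else 1) •
        (E k + (σ * form f (E k) / (1 - σ * form e f)) • (e - σ • f)) := by
  have hS : ∃ S : Matrix (Fin (n + 1)) (Fin (n + 1)) ℝ, IsLorentz S ∧ S.det = 1 ∧
      S *ᵥ X = X ∧ S *ᵥ Y = Y ∧ S *ᵥ e = σ • e ∧
      ∀ k, S *ᵥ E k = (if (k : ℕ) = 0 then σ else 1) • E k := by
    rcases hσ with rfl | rfl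
    · exact ⟨1, fun x y => by simp, by simp, by simp, by simp, by simp, by simp⟩
    · have he : form e e ≠ 0 := by rw [h.ee]; exact one_ne_zero
      let k₀ : Fin d := ⟨0, hd⟩
      have hk : form (E k₀) (E k₀) ≠ 0 := by rw [hE]; simp
      have hEx : ∀ x : Mink n, form x (E k₀) = 0 → reflection (E k₀) *ᵥ x = x := fun x hx =>
        reflection_of_orthogonal (by rw [form_comm, hx])
      refine ⟨reflection e * reflection (E k₀),
        (isLorentz_reflection he).mul (isLorentz_reflection hk),
        by rw [Matrix.det_mul, det_reflection he, det_reflection hk]; norm_num, ?_, ?_, ?_,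
        fun k => ?_⟩
      · rw [← Matrix.mulVec_mulVec, hEx _ (hXE _),
          reflection_of_orthogonal (by rw [form_comm, h.Xe])]
      · rw [← Matrix.mulVec_mulVec, hEx _ (hYE _),
          reflection_of_orthogonal (by rw [form_comm, h.Ye])]
      · rw [← Matrix.mulVec_mulVec, hEx _ (heE _), reflection_self he, neg_one_smul]
      · rw [← Matrix.mulVec_mulVec]
        by_cases hkk : (k : ℕ) = 0
        · have : k = k₀ := Fin.ext hkk
          rw [if_pos hkk, this, reflection_self hk, neg_one_smul, Matrix.mulVec_neg,
            reflection_of_orthogonal (heE _)]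
        · have : k ≠ k₀ := fun h0 => hkk (by rw [h0])
          rw [if_neg hkk, hEx _ (by rw [hE, if_neg this]), one_smul,
            reflection_of_orthogonal (heE _)]
  obtain ⟨S, hS, hSdet, hSX, hSY, hSe, hSE⟩ := hS
  have hσ2 : σ * σ = 1 := by rcases hσ with rfl | rfl <;> norm_num
  have hexp : Real.exp T * Real.exp (-T) = 1 := by
    rw [← Real.exp_add, add_neg_cancel, Real.exp_zero]
  have hκ0 := Real.exp_pos (-T)
  have hXY : form (X - Real.exp (-T) • Y) (X - Real.exp (-T) • Y) ≠ 0 := by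
    simp only [form_sub_left, form_sub_right, form_smul_left, form_smul_right, h.XX, h.YY, h.XY,
      form_comm Y X]
    linarith
  have hXX : form X X = form (Real.exp (-T) • Y) (Real.exp (-T) • Y) := by simp [h.XX, h.YY]
  have hff : form (e - σ • f) (e - σ • f) = 2 * (1 - σ * form e f) := by
    simp only [form_sub_left, form_sub_right, form_smul_left, form_smul_right, h.ee, h.ff,
      form_comm f e]
    linear_combination hσ2
  have hff0 : form (e - σ • f) (e - σ • f) ≠ 0 := by rw [hff]; linarith
  have hee : form e e = form (σ • f) (σ • f) := by
    simp only [form_smul_left, form_smul_right, h.ee, h.ff]; linarith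
  have hYL : reflection (X - Real.exp (-T) • Y) *ᵥ Y = Real.exp T • X := by
    have h1 := congrArg (fun x => Real.exp T • x) (reflection_sub' hXX hXY)
    simp only [Matrix.mulVec_smul, smul_smul, hexp, one_smul] at h1
    exact h1
  refine ⟨reflection (e - σ • f) * S * reflection (X - Real.exp (-T) • Y),
    ((isLorentz_reflection hff0).mul hS).mul (isLorentz_reflection hXY), ?_, ?_, ?_, ?_,
    fun k => ?_⟩
  · rw [Matrix.det_mul, Matrix.det_mul, det_reflection hff0, det_reflection hXY, hSdet]; norm_num
  · rw [← Matrix.mulVec_mulVec, ← Matrix.mulVec_mulVec, reflection_sub hXX hXY, Matrix.mulVec_smul,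
      hSY, reflection_of_orthogonal]
    simp [form_comm _ Y, h.Ye, h.Yf]
  · rw [← Matrix.mulVec_mulVec, ← Matrix.mulVec_mulVec, hYL, Matrix.mulVec_smul,
      hSX, reflection_of_orthogonal]
    simp [form_comm _ X, h.Xe, h.Xf]
  · rw [← Matrix.mulVec_mulVec, ← Matrix.mulVec_mulVec, reflection_of_orthogonal (x := e), hSe,
      Matrix.mulVec_smul, reflection_sub hee hff0, smul_smul, hσ2, one_smul]
    simp [h.Xe, h.Ye]
  · rw [← Matrix.mulVec_mulVec, ← Matrix.mulVec_mulVec, reflection_of_orthogonal (x := E k), hSE,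
      Matrix.mulVec_smul, reflection_mulVec, hff]
    · congr 1
      rw [sub_eq_add_neg, ← neg_smul]
      congr 2
      have : 1 - σ * form e f ≠ 0 := by linarith
      simp only [form_sub_left, form_smul_left, heE]
      field_simp
      ring
    · simp [hXE, hYE]

end Pants

/-! ### The fixed points of the cuffs span an ideal triangle -/

section Existence

variable {n : ℕ}

theorem exists_pos_mul_mul_eq {x y z : ℝ} (hx : 0 < x) (hy : 0 < y) (hz : 0 < z) :
    ∃ a b c : ℝ, 0 < a ∧ 0 < b ∧ 0 < c ∧ a * b * x = 3 / 2 ∧ a * c * y = 3 / 2 ∧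
      b * c * z = 3 / 2 := by
  have h0 : 0 < 3 / 2 * z / (x * y) := by positivity
  have ha := Real.sqrt_pos.2 h0
  have ha2 := Real.mul_self_sqrt h0.le
  set a := Real.sqrt (3 / 2 * z / (x * y))
  have ha3 : a * a * (x * y) = 3 / 2 * z := by rw [ha2]; field_simp
  refine ⟨a, 3 / 2 / (a * x), 3 / 2 / (a * y), ha, by positivity, by positivity, by field_simp,
    by field_simp, ?_⟩
  field_simp
  linarith

/-- The attracting fixed points of distinct cuffs are distinct. -/
theorem form_fixedPoints_neg {Γ : Subgroup (Matrix.SpecialLinearGroup (Fin (n + 1)) ℝ)}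
    (hΓ : IsHyperbolicManifoldGroup Γ) {ρ : PantsGroup →* Γ} (hρ : Function.Injective ρ)
    {p w : Fin 3 → Mink n} {l : Fin 3 → ℝ}
    (h : ∀ i, IsAxis (ρ (cuff i)).1 (p i) (w i) (l i)) {i j : Fin 3} (hij : i ≠ j) :
    form (p i + w i) (p j + w j) < 0 := by
  have hnull := fun i => (h i).unit.form_add_self (h i).base
  have hpos := fun i => (h i).unit.add_pos (h i).base
  wlog hlt : i < j generalizing i j
  · rw [form_comm]
    exact this hij.symm (lt_of_le_of_ne (not_lt.1 hlt) hij.symm)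
  refine lt_of_le_of_ne (form_nonpos (hnull i).le (hnull j).le (hpos i) (hpos j)) fun h0 => ?_
  have hprop := smul_eq_smul_of_form_eq_zero (hnull i) (hnull j) h0
  have hN : p i + w i = ((p j + w j) 0)⁻¹ • ((p i + w i) 0) • (p j + w j) := by
    rw [← hprop, smul_smul, inv_mul_cancel₀ (hpos j).ne', one_smul]
  have hfix : (ρ (cuff j)).1.1 *ᵥ (p i + w i) = Real.exp (l j) • (p i + w i) := by
    rw [hN, Matrix.mulVec_smul, Matrix.mulVec_smul, (h j).map_add]
    module
  obtain ⟨m, hm, hcomm⟩ := exists_pow_commute hΓ (ρ (cuff i)).2 (ρ (cuff j)).2 (h i) hfix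
  refine cuff_pow_not_commute hm hlt (hρ (Subtype.ext ?_))
  simpa using hcomm.eq

/-- The attracting fixed points of the cuffs, suitably scaled, span an ideal triangle. -/
theorem exists_isSpunTriangle {Γ : Subgroup (Matrix.SpecialLinearGroup (Fin (n + 1)) ℝ)}
    (hΓ : IsHyperbolicManifoldGroup Γ) {ρ : PantsGroup →* Γ} (hρ : Function.Injective ρ)
    {R ε : ℝ} (hcuff : IsCuffGood R ε ρ) :
    ∃ (V : Fin 3 → Mink n) (l : Fin 3 → ℝ),
      IsSpunTriangle (fun i => (ρ (cuff i)).1) V l ε ∧ ∀ i, |l i - 2 * R| ≤ 2 * ε := by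
  choose p w l haxis hl1 hl2 hmono using hcuff
  have hneg := fun i j => form_fixedPoints_neg hΓ hρ haxis (i := i) (j := j)
  obtain ⟨a₀, a₁, a₂, h0, h1, h2, h01, h02, h12⟩ := exists_pos_mul_mul_eq
    (neg_pos.2 (hneg 0 1 (by decide))) (neg_pos.2 (hneg 0 2 (by decide)))
    (neg_pos.2 (hneg 1 2 (by decide)))
  have ha : ∀ i, 0 < ![a₀, a₁, a₂] i := fun i => by fin_cases i; exacts [h0, h1, h2]
  have hform : ∀ i j, i < j → ![a₀, a₁, a₂] i * (![a₀, a₁, a₂] j *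
      form (p i + w i) (p j + w j)) = -3 / 2 := fun i j hij => by
    have h01' : a₀ * (a₁ * form (p 0 + w 0) (p 1 + w 1)) = -3 / 2 := by linarith
    have h02' : a₀ * (a₂ * form (p 0 + w 0) (p 2 + w 2)) = -3 / 2 := by linarith
    have h12' : a₁ * (a₂ * form (p 1 + w 1) (p 2 + w 2)) = -3 / 2 := by linarith
    rcases (by decide : ∀ i j : Fin 3, i < j →
      i = 0 ∧ j = 1 ∨ i = 0 ∧ j = 2 ∨ i = 1 ∧ j = 2) i j hij with ⟨rfl, rfl⟩ | ⟨rfl, rfl⟩ | ⟨rfl, rfl⟩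
    exacts [h01', h02', h12']
  generalize ![a₀, a₁, a₂] = a at ha hform
  refine ⟨fun i => a i • (p i + w i), l, ⟨⟨fun i => ?_, fun i => ?_, fun i j hij => ?_⟩,
    fun i => hΓ.isometries (ρ (cuff i)).2, ?_, fun i => ?_, fun i v hv => ?_⟩, fun i => ?_⟩
  · rw [form_smul_left, form_smul_right, (haxis i).unit.form_add_self (haxis i).base]; ring
  · exact mul_pos (ha i) ((haxis i).unit.add_pos (haxis i).base)
  · rw [form_smul_left, form_smul_right]
    rcases lt_or_gt_of_ne hij with hlt | hlt
    · exact hform i j hlt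
    · rw [form_comm, mul_left_comm]; exact hform j i hlt
  · rw [← Subgroup.coe_mul, ← Subgroup.coe_mul, ← map_mul, ← map_mul]
    simp [cuff]
  · rw [Matrix.mulVec_smul, (haxis i).map_add, smul_comm]
  · rw [form_smul_left] at hv
    exact (haxis i).form_map_sub_self_le (hΓ.isometries (ρ (cuff i)).2).1 (hmono i)
      ((mul_eq_zero.1 hv).resolve_left (ha i).ne')
  · rw [abs_le]
    constructor <;> linarith [hl1 i, hl2 i]

end Existence

/-! ### Comparison of the three edges -/

section Estimates

variable {n : ℕ} {c : Fin 3 → Matrix.SpecialLinearGroup (Fin (n + 1)) ℝ} {V : Fin 3 → Mink n}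
  {l : Fin 3 → ℝ} {ε : ℝ}

theorem IsSpunTriangle.form_map_eq_zero (h : IsSpunTriangle c V l ε) {i : Fin 3} {ζ : Mink n}
    (hζ : form (V i) ζ = 0) : form (V i) ((c i).1 *ᵥ ζ) = 0 := by
  have h1 := (h.isometry i).1 (V i) ζ
  rw [h.map, form_smul_left, hζ] at h1
  exact (mul_eq_zero.1 h1).resolve_left (Real.exp_pos _).ne'

/-- Up to a factor `2` and the monodromy, `ζ` and `c i ζ` are at the same distance from `ξ`. -/
theorem IsSpunTriangle.form_sub_le (h : IsSpunTriangle c V l ε) {i : Fin 3} {ζ ξ : Mink n}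
    (hζ : form (V i) ζ = 0) (hξ : form (V i) ξ = 0) :
    form ((c i).1 *ᵥ ζ - ξ) ((c i).1 *ᵥ ζ - ξ) ≤
      2 * form (ζ - ξ) (ζ - ξ) + 2 * (ε ^ 2 * form ζ ζ) ∧
    form (ζ - ξ) (ζ - ξ) ≤
      2 * form ((c i).1 *ᵥ ζ - ξ) ((c i).1 *ᵥ ζ - ξ) + 2 * (ε ^ 2 * form ζ ζ) := by
  have hm := h.monodromy i ζ hζ
  have hc := h.form_map_eq_zero hζ
  have h1 := form_add_self_le (h.null i).le (h.pos i).ne' (x := ζ - ξ) (y := (c i).1 *ᵥ ζ - ζ)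
    (by rw [form_sub_right, hζ, hξ, sub_zero]) (by rw [form_sub_right, hc, hζ, sub_zero])
  have h2 := form_add_self_le (h.null i).le (h.pos i).ne' (x := (c i).1 *ᵥ ζ - ξ)
    (y := -((c i).1 *ᵥ ζ - ζ))
    (by rw [form_sub_right, hc, hξ, sub_zero])
    (by rw [form_neg_right, form_sub_right, hc, hζ, sub_zero, neg_zero])
  rw [show ζ - ξ + ((c i).1 *ᵥ ζ - ζ) = (c i).1 *ᵥ ζ - ξ by abel] at h1
  rw [show (c i).1 *ᵥ ζ - ξ + -((c i).1 *ᵥ ζ - ζ) = ζ - ξ by abel,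
    form_neg_left ((c i).1 *ᵥ ζ - ζ), form_neg_right, neg_neg] at h2
  exact ⟨by linarith, by linarith⟩

/-- The fold along the edges at the vertex `V i` is the same up to the monodromy of `c i`. -/
theorem IsSpunTriangle.form_fold_le (h : IsSpunTriangle c V l ε) (σ : ℝ) (i : Fin 3) :
    form (oppositeNormal c V l (i + 1) + σ • normal V (i + 1))
        (oppositeNormal c V l (i + 1) + σ • normal V (i + 1)) ≤
      2 * form (oppositeNormal c V l (i + 2) + σ • normal V (i + 2))
        (oppositeNormal c V l (i + 2) + σ • normal V (i + 2)) + 2 * ε ^ 2 ∧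
    form (oppositeNormal c V l (i + 2) + σ • normal V (i + 2))
        (oppositeNormal c V l (i + 2) + σ • normal V (i + 2)) ≤
      2 * form (oppositeNormal c V l (i + 1) + σ • normal V (i + 1))
        (oppositeNormal c V l (i + 1) + σ • normal V (i + 1)) + 2 * ε ^ 2 := by
  obtain ⟨α, hα⟩ := normal_succ V i
  obtain ⟨β, hβ⟩ := h.oppositeNormal_succ i
  have hE := h.isEdge (i + 2)
  rw [(by decide : ∀ i : Fin 3, i + 2 + 1 = i) i] at hE
  have hc := h.form_map_eq_zero hE.Yf
  have hs := h.form_sub_le hE.Yf (ξ := -(σ • normal V (i + 2)))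
    (by rw [form_neg_right, form_smul_right, hE.Ye]; ring)
  rw [hE.ff, mul_one, sub_neg_eq_add, sub_neg_eq_add] at hs
  have hform : form (oppositeNormal c V l (i + 1) + σ • normal V (i + 1))
      (oppositeNormal c V l (i + 1) + σ • normal V (i + 1)) =
      form ((c i).1 *ᵥ oppositeNormal c V l (i + 2) + σ • normal V (i + 2))
        ((c i).1 *ᵥ oppositeNormal c V l (i + 2) + σ • normal V (i + 2)) := by
    set y := (c i).1 *ᵥ oppositeNormal c V l (i + 2) + σ • normal V (i + 2) with hy
    have hVy : form (V i) y = 0 := by rw [hy, form_add_right, hc, form_smul_right, hE.Ye]; ring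
    have : oppositeNormal c V l (i + 1) + σ • normal V (i + 1) = -y + (β + σ * α) • V i := by
      rw [hα, hβ, hy]; module
    rw [this]
    simp only [form_add_left, form_add_right, form_neg_left, form_neg_right, form_smul_left,
      form_smul_right, hVy, form_comm y (V i), h.null]
    ring
  rw [hform]
  exact hs

/-- Along the last edge the triangles are almost unfolded or almost folded, according to the
sign `σ`. -/
theorem IsSpunTriangle.form_fold_two_le (h : IsSpunTriangle c V l ε) {σ : ℝ} (hσ : σ ^ 2 = 1)
    (hr : σ * form (normal V 2) (oppositeNormal c V l 2) ≤ 0) :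
    form (oppositeNormal c V l 2 + σ • normal V 2) (oppositeNormal c V l 2 + σ • normal V 2) ≤
      9 / 2 * ε ^ 2 := by
  have hE := h.isEdge 2
  have h1 := h.one_sub_form_normal_sq_le 2
  have habs := abs_le.1 hE.abs_form_le
  simp only [form_add_left, form_add_right, form_smul_left, form_smul_right, hE.ee, hE.ff,
    form_comm (oppositeNormal c V l 2) (normal V 2)]
  generalize form (normal V 2) (oppositeNormal c V l 2) = r at *
  rcases eq_or_eq_neg_of_sq_eq_sq σ 1 (by rw [hσ, one_pow]) with rfl | rfl <;> nlinarith

theorem IsSpunTriangle.form_fold_all_le (h : IsSpunTriangle c V l ε) {σ : ℝ} (hσ : σ ^ 2 = 1)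
    (hr : σ * form (normal V 2) (oppositeNormal c V l 2) ≤ 0) (i : Fin 3) :
    form (oppositeNormal c V l i + σ • normal V i) (oppositeNormal c V l i + σ • normal V i) ≤
      11 * ε ^ 2 := by
  have h2 := h.form_fold_two_le hσ hr
  have h1 := (h.form_fold_le σ 0).1
  have h0 := (h.form_fold_le σ 1).2
  simp only [zero_add] at h1
  rw [show (1 : Fin 3) + 2 = 0 from rfl, show (1 : Fin 3) + 1 = 2 from rfl] at h0
  have := sq_nonneg ε
  rcases (by decide : ∀ i : Fin 3, i = 0 ∨ i = 1 ∨ i = 2) i with rfl | rfl | rfl <;> linarith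

/-- A normal vector of the second triangle that is close to a normal vector of the first one across
the last edge is close to it across the other two edges as well. -/
theorem IsSpunTriangle.form_connector_sub_le (h : IsSpunTriangle c V l ε) {η ξ : Mink n}
    (hη : ∀ i, form (opposite c V l i) η = 0) (hξ : ∀ i, form (V i) ξ = 0)
    (h2 : form (η - ξ) (η - ξ) ≤ 9 / 2 * ε ^ 2 * form η η) (i : Fin 3) :
    form ((connector c i).1 *ᵥ η - ξ) ((connector c i).1 *ᵥ η - ξ) ≤ 11 * ε ^ 2 * form η η := by
  have hg : ∀ i, form (V i) ((connector c (i + 2)).1 *ᵥ η) = 0 := fun i => by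
    have h3 := (h.connector_opposite (i + 2)).1
    rw [(by decide : ∀ i : Fin 3, i + 2 + 1 = i) i] at h3
    have h4 := (h.connector_mem (i + 2)).1 (opposite c V l (-(i + 2))) η
    rw [hη, h3, form_smul_left] at h4
    exact (mul_eq_zero.1 h4).resolve_left (Real.exp_pos _).ne'
  have hc : ∀ i, (c i).1 *ᵥ ((connector c (i + 2)).1 *ᵥ η) = (connector c (i + 1)).1 *ᵥ η :=
    fun i => by
      rw [Matrix.mulVec_mulVec, ← Matrix.SpecialLinearGroup.coe_mul, ← h.connector_mul_inv i,
        (by decide : ∀ i : Fin 3, i - 1 = i + 2) i, inv_mul_cancel_right]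
  have key := fun i => h.form_sub_le (hg i) (hξ i)
  simp only [hc, (h.connector_mem _).1 η η] at key
  have hone : (connector c 2).1 *ᵥ η = η := Matrix.one_mulVec η
  have hηη : 0 ≤ form η η := by
    rw [← (h.connector_mem (0 + 2)).1 η η]
    exact form_self_nonneg (h.null 0).le (h.pos 0).ne' (hg 0)
  have hpos := mul_nonneg (sq_nonneg ε) hηη
  have h1 := (key 0).1
  have h0 := (key 1).2
  simp only [zero_add, hone] at h1
  rw [show (1 : Fin 3) + 2 = 0 from rfl, show (1 : Fin 3) + 1 = 2 from rfl, hone] at h0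
  rcases (by decide : ∀ i : Fin 3, i = 0 ∨ i = 1 ∨ i = 2) i with rfl | rfl | rfl
  · linarith
  · linarith
  · rw [hone]; linarith

theorem abs_shear_sub_le {R : ℝ} (hl : ∀ i, |l i - 2 * R| ≤ 2 * ε) (i : Fin 3) :
    |shear l i - R| ≤ 3 * ε := by
  have h0 := abs_le.1 (hl i)
  have h1 := abs_le.1 (hl (i + 1))
  have h2 := abs_le.1 (hl (i + 2))
  rw [shear, abs_le]
  constructor <;> linarith

/-- The error terms are negligible for large `R`. -/
theorem exp_neg_bounds {R T : ℝ} (hε : 0 < ε) (hR : 100 + 10 * ε + 100 / ε ^ 2 < R)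
    (hT : |T - R| ≤ 3 * ε) :
    Real.exp (-T) ≤ 1 / 100 ∧ Real.exp (-T) ≤ ε / 20 ∧ Real.exp (-T) ≤ ε ^ 2 / 100 ∧
      10 * Real.exp (-T) ^ 2 ≤ Real.exp (-(R / 4)) ^ 2 := by
  have hT' := abs_le.1 hT
  have h0 : 0 < 100 / ε ^ 2 := by positivity
  have hTR : 100 + 100 / ε ^ 2 ≤ T := by linarith
  have hle : Real.exp (-T) ≤ 1 / T := by
    rw [Real.exp_neg, ← one_div]
    exact one_div_le_one_div_of_le (by linarith) (by linarith [Real.add_one_le_exp T])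
  have h1 : 1 / T ≤ 1 / 100 := one_div_le_one_div_of_le (by norm_num) (by linarith)
  have hz : ε ^ 2 * (100 / ε ^ 2) = 100 := mul_div_cancel₀ _ (by positivity)
  generalize 100 / ε ^ 2 = z at *
  have hT0 : 0 < T := by linarith
  have h2 : 1 / T ≤ ε ^ 2 / 100 := by
    rw [div_le_iff₀ hT0]
    nlinarith [mul_le_mul_of_nonneg_left hTR (sq_nonneg ε)]
  have h3 : 1 / T ≤ ε / 20 := by
    rw [div_le_iff₀ hT0]
    have h4 := mul_le_mul_of_nonneg_left hTR hε.le
    rcases le_total ε 1 with h5 | h5 <;> nlinarith [mul_pos hε h0]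
  refine ⟨hle.trans h1, hle.trans h3, hle.trans h2, ?_⟩
  rw [← Real.exp_nat_mul, ← Real.exp_nat_mul]
  have h5 : (10 : ℝ) ≤ Real.exp 9 := by linarith [Real.add_one_le_exp (9 : ℝ)]
  calc 10 * Real.exp ((2 : ℕ) * -T) ≤ Real.exp 9 * Real.exp ((2 : ℕ) * -T) := by gcongr
    _ = Real.exp (9 + (2 : ℕ) * -T) := (Real.exp_add _ _).symm
    _ ≤ _ := Real.exp_le_exp.2 (by push_cast; linarith)

end Estimates

/-! ### Framed tripods that generate the pants -/

section Main

variable {d : ℕ}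

theorem diagonal_signs_one (m : ℕ) : Matrix.diagonal (signs 1 m) = 1 := by
  rw [← Matrix.diagonal_one]
  congr 1
  ext j
  simp [signs]

/-- Framed tripods at the barycenters of the two ideal triangles generate the pants, with monodromy
determined by the sign `σ` of the fold along the last edge. -/
theorem isGenerated_of_isSpunTriangle (hd : 1 ≤ d)
    {Γ : Subgroup (Matrix.SpecialLinearGroup (Fin (d + 2 + 1)) ℝ)} {ρ : PantsGroup →* Γ}
    {V : Fin 3 → Mink (d + 2)} {l : Fin 3 → ℝ} {R ε σ : ℝ}
    (h : IsSpunTriangle (fun i => (ρ (cuff i)).1) V l ε) (hl : ∀ i, |l i - 2 * R| ≤ 2 * ε)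
    (hε : 0 < ε) (hR : 100 + 10 * ε + 100 / ε ^ 2 < R) (hσ : σ = 1 ∨ σ = -1)
    (hr : σ * form (normal V 2) (oppositeNormal (fun i => (ρ (cuff i)).1) V l 2) ≤ 0) :
    IsGenerated R (10 * ε) (Matrix.diagonal (signs σ (d + 2))) ρ := by
  have hσ2 : σ ^ 2 = 1 := by rcases hσ with rfl | rfl <;> norm_num
  set c : Fin 3 → Matrix.SpecialLinearGroup (Fin (d + 2 + 1)) ℝ := fun i => (ρ (cuff i)).1 with hc
  obtain ⟨P, hPb, hPv⟩ := h.exists_framedTripod hd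
  have hedge := h.isEdge 2
  have hPE : ∀ i k, form (V i) (P.E k) = 0 := fun i k => by
    have hb : form P.base (P.E k) = 0 := (P.frame 0).tangent k.succ.succ
    have h1 : form (P.v (i + 1)) (P.E k) = 0 := by
      simpa [tripodFrame, (Fin.succ_ne_zero _).symm] using
        (P.frame (i + 1)).orthonormal 0 k.succ.succ
    rw [hPv, ← hPb, form_sub_left, hb, (by decide : ∀ i : Fin 3, i + 1 + 2 = i) i] at h1
    linarith
  have hEE : ∀ k k', form (P.E k) (P.E k') = if k = k' then 1 else 0 := fun k k' => by
    simpa [tripodFrame] using (P.frame 0).orthonormal k.succ.succ k'.succ.succ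
  have heE : ∀ i k, form (normal V i) (P.E k) = 0 := fun i k => by simp [normal, hPE]
  obtain ⟨L, hL, hLdet, hLX, hLY, hLe, hLE⟩ := exists_lorentz_of_isEdge (T := shear l 2) hd hσ
    hedge hr hEE (fun k => hPE _ k) (fun k => hPE _ k) (heE 2)
  -- `L` carries the first ideal triangle to the second one.
  have hLV : ∀ i, L *ᵥ V i = opposite c V l i := fun i => by
    have h0 : L *ᵥ V 0 = opposite c V l 0 := hLY
    have h1 : L *ᵥ V 1 = opposite c V l 1 := hLX
    have h2 : L *ᵥ V 2 = opposite c V l 2 := by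
      have h3 : V 2 = V 0 + V 1 + Real.sqrt 3 • normal V 2 := by
        rw [sqrt_three_smul_normal]
        show V 2 = V 0 + V 1 + (V 2 - V 0 - V 1)
        abel
      have h4 := h.connector_opposite_self 2
      have h5 : opposite c V l 2 = Real.exp (shear l 2) • V 1 + Real.exp (-shear l 2) • V 0 +
          Real.sqrt 3 • oppositeNormal c V l 2 := by
        rw [← Matrix.one_mulVec (opposite c V l 2)]; exact h4
      rw [h5]
      conv_lhs => rw [h3]
      rw [Matrix.mulVec_add, Matrix.mulVec_add, Matrix.mulVec_smul, hLe, h0, h1]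
      rfl
    rcases (by decide : ∀ i : Fin 3, i = 0 ∨ i = 1 ∨ i = 2) i with rfl | rfl | rfl
    exacts [h0, h1, h2]
  have hLc : L *ᵥ center V = center (opposite c V l) := by
    simp only [center, Matrix.mulVec_smul, Matrix.mulVec_add, hLV]
  have hbase : L *ᵥ P.base ∈ hyp (d + 2) := by
    rw [hPb, hLc]; exact h.isIdealTriangle_opposite.center_mem
  let Q := P.shiftedMap L hL hLdet hbase
  have hQb : Q.base = center (opposite c V l) := by rw [← hLc, ← hPb]; rfl
  have hQv : ∀ j, Q.v j = opposite c V l j - center (opposite c V l) := fun j => by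
    show L *ᵥ P.v (j + 1) = _
    rw [hPv, Matrix.mulVec_sub, hLc, hLV, (by decide : ∀ j : Fin 3, j + 1 + 2 = j) j]
  have hperp : ∀ {m : ℕ} (v W : Fin 3 → Mink m) (x : Mink m) (j k : Fin 3),
      (∀ j, v j = W (j + k) - x) →
      perp v j = normal W (j + 1 + k) + (Real.sqrt 3)⁻¹ • W (j + k) := fun v W x j k hv => by
    rw [perp, hv, hv, normal,
      (by decide : ∀ j k : Fin 3, j + 1 + k + 1 = j + 2 + k) j k,
      (by decide : ∀ j k : Fin 3, j + 1 + k + 2 = j + k) j k]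
    module
  -- The connections `γ 1`, `γ 2` and `γ 0` end at `c 0`, `1` and `(c 1)⁻¹` times the second tripod.
  let γ : Fin 3 → Γ := ![(ρ (cuff 1))⁻¹, ρ (cuff 0), 1]
  have hγ : ∀ i, (γ i).1 = connector c i := fun i => by fin_cases i <;> rfl
  refine ⟨P, Q, γ, 1, fun i => ?_, fun i => Subtype.ext ?_⟩
  swap
  · rw [one_mul, inv_one, mul_one]
    show (γ (i + 1)).1 * ((γ (i - 1)).1)⁻¹ = _
    rw [hγ, hγ]
    exact h.connector_mul_inv i
  rw [hγ]
  have hgb : (connector c i).1 *ᵥ Q.base =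
      barycenter (V (i + 2)) (V (i + 1)) (oppositeNormal c V l i) (shear l i) := by
    rw [hQb, center_eq _ (1 - i), (by decide : ∀ i : Fin 3, 1 - i + 1 = -i + 2) i,
      (by decide : ∀ i : Fin 3, 1 - i + 2 = -i) i, Matrix.mulVec_smul, Matrix.mulVec_add,
      Matrix.mulVec_add, h.connector_opposite_self, (h.connector_opposite i).1,
      (h.connector_opposite i).2, barycenter]
    module
  have hPbar : P.base = barycenter (V (i + 2)) (V (i + 1)) (normal V i) 0 := by
    rw [hPb, center_eq _ i, barycenter, sqrt_three_smul_normal, neg_zero, Real.exp_zero]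
    module
  have hTR := abs_shear_sub_le hl i
  obtain ⟨hT1, hT2, hT3, hT4⟩ := exp_neg_bounds hε hR hTR
  refine isConnection_of_isEdge (h.connector_mem i) hσ2 (h.isEdge i) hPbar hgb (by rw [hPv, hPb])
    ?_ ?_ ?_ hε hTR hT1 hT2 hT3 hT4 (h.form_fold_all_le hσ2 hr i) fun a => ?_
  · rw [hperp P.v V _ i 2 hPv, (by decide : ∀ i : Fin 3, i + 1 + 2 = i) i]
  · rw [hQv, Matrix.mulVec_sub, (h.connector_opposite i).1, hQb]
  · rw [hperp Q.v (opposite c V l) _ (-i) 0 (by simpa using hQv), add_zero, add_zero,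
      Matrix.mulVec_add, Matrix.mulVec_smul, (h.connector_opposite i).1, oppositeNormal,
      (by decide : ∀ i : Fin 3, -i + 1 = 1 - i) i, smul_smul, mul_comm]
  -- The normal frames are close across the last edge, hence across all edges.
  set s : Fin d → ℝ := fun k => if (k : ℕ) = 0 then σ else 1 with hs
  set ξ := ∑ k, a k • s k • P.E k with hξ
  set η := ∑ k, a k • (L *ᵥ P.E k) with hη
  have hs2 : ∀ k, s k ^ 2 = 1 := fun k => by simp only [hs]; split_ifs <;> simp [hσ2]
  have hsum : ∑ k, a k • ((connector c i).1 *ᵥ Q.E k - s k • P.E k) =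
      (connector c i).1 *ᵥ η - ξ := by
    rw [hη, hξ, Matrix.mulVec_sum, ← Finset.sum_sub_distrib]
    refine Finset.sum_congr rfl fun k _ => ?_
    rw [Matrix.mulVec_smul, smul_sub]
    rfl
  have hηη : form η η = ∑ k, a k ^ 2 := by
    simp only [hη, form_sum_left, form_sum_right, form_smul_left, form_smul_right, hL _ _, hEE]
    simp [sq]
  have hξξ : form ξ ξ = ∑ k, a k ^ 2 := by
    simp only [hξ, form_sum_left, form_sum_right, form_smul_left, form_smul_right, hEE]
    simp only [mul_ite, mul_one, mul_zero, Finset.sum_ite_eq', Finset.mem_univ, if_true]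
    refine Finset.sum_congr rfl fun k _ => ?_
    linear_combination a k ^ 2 * hs2 k
  have hξV : ∀ i, form (V i) ξ = 0 := fun i => by rw [hξ, form_sum_right]; simp [hPE]
  have hηU : ∀ i, form (opposite c V l i) η = 0 := fun i => by
    rw [hη, form_sum_right]; simp [← hLV, hL _ _, hPE]
  rw [hsum, ← hηη]
  refine h.form_connector_sub_le hηU hξV ?_ i
  have hsq := h.form_oppositeNormal_sq_le hξV 2
  rw [form_comm ξ] at hsq
  rw [hηη, ← hξξ]
  set e := normal V 2
  set f := oppositeNormal c V l 2
  have hdiff : η - ξ = (σ * form f ξ / (1 - σ * form e f)) • (e - σ • f) := by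
    rw [hη, hξ, ← Finset.sum_sub_distrib, form_sum_right, Finset.mul_sum, Finset.sum_div,
      Finset.sum_smul]
    refine Finset.sum_congr rfl fun k _ => ?_
    rw [hLE, form_smul_right, form_smul_right]
    simp only [hs]
    module
  have hff : form (e - σ • f) (e - σ • f) = 2 * (1 - σ * form e f) := by
    simp only [form_sub_left, form_sub_right, form_smul_left, form_smul_right, hedge.ee, hedge.ff,
      form_comm f e]
    linear_combination hσ2
  have hden : 1 ≤ 1 - σ * form e f := by linarith
  rw [hdiff, form_smul_left, form_smul_right, hff]
  have hden0 : 1 - σ * form e f ≠ 0 := by linarith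
  have : σ * form f ξ / (1 - σ * form e f) * (σ * form f ξ / (1 - σ * form e f) *
      (2 * (1 - σ * form e f))) = 2 * form f ξ ^ 2 / (1 - σ * form e f) := by
    field_simp
    linear_combination form f ξ ^ 2 * hσ2
  rw [this]
  refine (div_le_self (by positivity) hden).trans ?_
  linarith

end Main

end HypPants

theorem theorem2p9 :
    ∃ C : ℝ, 0 < C ∧ ∀ ε : ℝ, 0 < ε → ∃ R₀ : ℝ, 0 < R₀ ∧ ∀ R : ℝ, R₀ < R →
      ∀ d : ℕ, 1 ≤ d →
      ∀ Γ : Subgroup (Matrix.SpecialLinearGroup (Fin (d + 2 + 1)) ℝ), IsHyperbolicManifoldGroup Γ →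
      ∀ ρ : PantsGroup →* Γ, Function.Injective ρ → IsCuffGood R ε ρ →
        IsGoodPants R (C * ε) ρ ∨ IsBadPants R (C * ε) ρ := by
  refine ⟨10, by norm_num, fun ε hε => ⟨100 + 10 * ε + 100 / ε ^ 2, by positivity,
    fun R hR d hd Γ hΓ ρ hρ hcuff => ?_⟩⟩
  obtain ⟨V, l, h, hl⟩ := exists_isSpunTriangle hΓ hρ hcuff
  rcases le_total (form (normal V 2) (oppositeNormal (fun i => (ρ (cuff i)).1) V l 2)) 0
    with h0 | h0
  · left
    rw [IsGoodPants, ← diagonal_signs_one]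
    exact isGenerated_of_isSpunTriangle hd h hl hε hR (Or.inl rfl) (by linarith)
  · right
    exact isGenerated_of_isSpunTriangle hd h hl hε hR (Or.inr rfl) (by linarith)
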